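/- Let $\mathbb H$ be the quaternions, $n\in\mathbb N$, $Q=4n+6$, $0<\lambda<Q$ and $p=\frac{2Q}{2Q-\lambda}$. Let $S=\{\zeta=(\zeta',\zeta_{n+1})\in\mathbb H^n\times\mathbb H:|\zeta'|^2+|\zeta_{n+1}|^2=1\}$ with Lebesgue surface measure $d\zeta$, write $\zeta\cdot\bar\eta=\sum_{j=1}^{n+1}\zeta_j\overline{\eta_j}$, and let $d_S(\zeta,\eta)=2^{-1/2}|1-\zeta\cdot\bar\eta|^{1/2}$. Let $C'$ be the sharp (smallest) constant in the Hardy–Littlewood–Sobolev (HLS) inequality on the sphere $$\Big|\iint_{S\times S}\frac{\overline{f(\zeta)}\,g(\eta)}{d_S(\zeta,\eta)^{\lambda}}\,d\zeta\,d\eta\Big|\le C'\,\|f\|_{L^p(S)}\|g\|_{L^p(S)}\qquad\text{for all } f,g\in L^p(S).$$ A positive extremizer is a function $h\in L^p(S)$, $h>0$ almost everywhere, for which equality holds with $f=g=h$. Let $G=\mathbb H^n\times\operatorname{Im}\mathbb H$ be the quaternionic Heisenberg group, with product $(q,w)(q',w')=(q+q',\,w+w'+2\operatorname{Im}(q\cdot\overline{q'}))$.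 Let $\operatorname{Aut}(G)$ be the conformal group of $G$, i.e. the group of transformations of $G\cup\{\infty\}$ generated by the left translations, the dilations $(q,w)\mapsto(\delta q,\delta^2w)$, $\delta>0$, the rotations $(q,w)\mapsto(qA,w)$, $A\in Sp(n)$ (all of these fixing $\infty$), and the inversion $(q,w)\mapsto\big(-(|q|^2-w)^{-1}q,\,-\tfrac{w}{|q|^4+|w|^2}\big)$, which exchanges $0$ and $\infty$. Let $\mathcal C:G\cup\{\infty\}\to S$ be the Cayley transform, the bijection with $\mathcal C(q,w)=\big((1+|q|^2-w)^{-1}2q,\,(1+|q|^2-w)^{-1}(1-|q|^2+w)\big)$ and $\mathcal C(\infty)=(0,\dots,0,-1)$. The conformal transformations of $S$ are the elements of $\operatorname{Aut}(S)=\{\mathcal C\circ\sigma\circ\mathcal C^{-1}:\sigma\in\operatorname{Aut}(G)\}$; $|J_\tau|$ denotes the Jacobian determinant of $\tau\in\operatorname{Aut}(S)$ with respect to the surface measure. Then for every positive extremizer $h$ of the HLS inequality on $S$ there is a conformal transformation $\gamma\in\operatorname{Aut}(S)$ such that $$\tilde h=|J_{\gamma^{-1}}|^{1/p}\;h\circ\gamma^{-1}$$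 is again a positive extremizer and satisfies the zero center-mass condition $$\int_S\zeta\,\tilde h(\zeta)^p\,d\zeta=0 .$$ -/

import Mathlib

open MeasureTheory
open scoped Quaternion ComplexConjugate

noncomputable section

namespace QuatHLS

/-! ### The quaternionic Heisenberg group -/

/-- The quaternionic scalar product `q · q̄' = ∑ⱼ qⱼ q̄'ⱼ` on `ℍⁿ`. -/
def qdot {n : ℕ} (q q' : EuclideanSpace ℍ[ℝ] (Fin n)) : ℍ[ℝ] := ∑ j, q j * star (q' j)

/-- The quaternionic Heisenberg group `G = ℍⁿ × Im ℍ`. -/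
@[ext]
structure QHeis (n : ℕ) where
  /-- the horizontal coordinate -/
  q : EuclideanSpace ℍ[ℝ] (Fin n)
  /-- the central coordinate -/
  w : ℍ[ℝ]
  re_w : w.re = 0

variable {n : ℕ}

theorem qdot_add_left (a b c : EuclideanSpace ℍ[ℝ] (Fin n)) :
    qdot (a + b) c = qdot a c + qdot b c := by
  simp [qdot, add_mul, Finset.sum_add_distrib]

theorem qdot_add_right (a b c : EuclideanSpace ℍ[ℝ] (Fin n)) :
    qdot a (b + c) = qdot a b + qdot a c := by
  simp [qdot, mul_add, Finset.sum_add_distrib]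

theorem qdot_neg_left (a b : EuclideanSpace ℍ[ℝ] (Fin n)) : qdot (-a) b = -qdot a b := by
  simp [qdot]

theorem qdot_zero_left (b : EuclideanSpace ℍ[ℝ] (Fin n)) : qdot 0 b = 0 := by
  simp [qdot]

theorem qdot_self (a : EuclideanSpace ℍ[ℝ] (Fin n)) : qdot a a = ((‖a‖ ^ 2 : ℝ) : ℍ[ℝ]) := by
  rw [PiLp.norm_sq_eq_of_L2]
  simp only [qdot, Quaternion.self_mul_star, Quaternion.normSq_eq_norm_mul_self, ← sq]
  exact (map_sum (algebraMap ℝ ℍ[ℝ]) (fun i => ‖a i‖ ^ 2) Finset.univ).symm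

theorem im_qdot_self (a : EuclideanSpace ℍ[ℝ] (Fin n)) : (qdot a a).im = 0 := by
  rw [qdot_self, Quaternion.im_coe]

namespace QHeis

/-- The group law `(q,w)(q',w') = (q + q', w + w' + 2 Im (q · q̄'))`. -/
instance : Mul (QHeis n) :=
  ⟨fun u v => ⟨u.q + v.q, u.w + v.w + (2 : ℝ) • (qdot u.q v.q).im, by simp [u.re_w, v.re_w]⟩⟩

instance : One (QHeis n) := ⟨⟨0, 0, rfl⟩⟩

instance : Inv (QHeis n) := ⟨fun u => ⟨-u.q, -u.w, by simp [u.re_w]⟩⟩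

instance : Group (QHeis n) :=
  Group.ofLeftAxioms
    (by
      intro a b c
      apply QHeis.ext
      · exact add_assoc _ _ _
      · change a.w + b.w + (2 : ℝ) • (qdot a.q b.q).im + c.w + (2 : ℝ) • (qdot (a.q + b.q) c.q).im =
          a.w + (b.w + c.w + (2 : ℝ) • (qdot b.q c.q).im) + (2 : ℝ) • (qdot a.q (b.q + c.q)).im
        rw [qdot_add_left, qdot_add_right, Quaternion.im_add, Quaternion.im_add,
          smul_add, smul_add]
        abel)
    (by
      intro a
      apply QHeis.ext
      · exact zero_add _
      · change 0 + a.w + (2 : ℝ) • (qdot 0 a.q).im = a.w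
        simp [qdot_zero_left])
    (by
      intro a
      apply QHeis.ext
      · exact neg_add_cancel _
      · change -a.w + a.w + (2 : ℝ) • (qdot (-a.q) a.q).im = 0
        simp [qdot_neg_left, im_qdot_self])

/-- The group dilation `(q, w) ↦ (δ q, δ² w)`, `δ > 0`. -/
def dilation (δ : ℝ) (hδ : 0 < δ) : Equiv.Perm (QHeis n) where
  toFun u := ⟨δ • u.q, δ ^ 2 • u.w, by simp [u.re_w]⟩
  invFun u := ⟨δ⁻¹ • u.q, (δ ^ 2)⁻¹ • u.w, by simp [u.re_w]⟩
  left_inv u := by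
    apply QHeis.ext
    · exact inv_smul_smul₀ hδ.ne' _
    · exact inv_smul_smul₀ (pow_ne_zero 2 hδ.ne') _
  right_inv u := by
    apply QHeis.ext
    · exact smul_inv_smul₀ hδ.ne' _
    · exact smul_inv_smul₀ (pow_ne_zero 2 hδ.ne') _

/-- The rotation `(q, w) ↦ (q A, w)`, with `A ∈ Sp(n)` (so `A*A = AA* = I`) acting on the row
vector `q` from the right. -/
def rotation (A : unitary (Matrix (Fin n) (Fin n) ℍ[ℝ])) : Equiv.Perm (QHeis n) where
  toFun u := ⟨WithLp.toLp 2 (Matrix.vecMul u.q.ofLp (A : Matrix (Fin n) (Fin n) ℍ[ℝ])), u.w, u.re_w⟩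
  invFun u :=
    ⟨WithLp.toLp 2 (Matrix.vecMul u.q.ofLp (star (A : Matrix (Fin n) (Fin n) ℍ[ℝ]))), u.w, u.re_w⟩
  left_inv u := by
    apply QHeis.ext
    · simp [Matrix.vecMul_vecMul]
    · rfl
  right_inv u := by
    apply QHeis.ext
    · simp [Matrix.vecMul_vecMul]
    · rfl

/-- The quaternion `|q|² - w`. -/
def rho (u : QHeis n) : ℍ[ℝ] := ((‖u.q‖ ^ 2 : ℝ) : ℍ[ℝ]) - u.w

theorem re_rho (u : QHeis n) : u.rho.re = ‖u.q‖ ^ 2 := by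
  simp only [rho, Quaternion.re_sub, Quaternion.re_coe, u.re_w, sub_zero]

theorem im_rho (u : QHeis n) : u.rho.im = -u.w := by
  have h := u.re_w
  rw [rho, Quaternion.im_sub, Quaternion.im_coe, zero_sub]
  ext <;> simp [h]

theorem norm_rho_sq (u : QHeis n) : ‖u.rho‖ ^ 2 = ‖u.q‖ ^ 4 + ‖u.w‖ ^ 2 := by
  have h := u.re_w
  rw [sq, ← Quaternion.normSq_eq_norm_mul_self, sq ‖u.w‖, ← Quaternion.normSq_eq_norm_mul_self,
    Quaternion.normSq_def', Quaternion.normSq_def', re_rho, h]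
  simp only [rho, Quaternion.imI_sub, Quaternion.imJ_sub, Quaternion.imK_sub, Quaternion.imI_coe,
    Quaternion.imJ_coe, Quaternion.imK_coe]
  ring

theorem rho_eq_zero {u : QHeis n} (h : u.rho = 0) : u = 1 := by
  have h1 := re_rho u
  have h2 := im_rho u
  rw [h] at h1 h2
  apply QHeis.ext
  · change u.q = 0
    simpa using h1.symm
  · change u.w = 0
    simpa using h2.symm

theorem rho_one : (1 : QHeis n).rho = 0 := by
  change ((‖(0 : EuclideanSpace ℍ[ℝ] (Fin n))‖ ^ 2 : ℝ) : ℍ[ℝ]) - 0 = 0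
  simp

theorem one_add_rho_ne_zero (u : QHeis n) : 1 + u.rho ≠ 0 := by
  intro h
  have h1 : (1 + u.rho).re = (0 : ℍ[ℝ]).re := by rw [h]
  rw [Quaternion.re_add, Quaternion.re_one, re_rho, Quaternion.re_zero] at h1
  nlinarith [sq_nonneg ‖u.q‖]

open Classical in
/-- The underlying map of the inversion
`(q, w) ↦ (-(|q|² - w)⁻¹ q, -w / (|q|⁴ + |w|²))`
on `G ∪ {∞}`, where `∞` is `none`; it exchanges the identity element and `∞`. -/
def invFn : Option (QHeis n) → Option (QHeis n)
  | none => some 1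
  | some u => if u = 1 then none else
      some ⟨-(u.rho⁻¹ • u.q), -((‖u.q‖ ^ 4 + ‖u.w‖ ^ 2)⁻¹ • u.w), by simp [u.re_w]⟩

theorem rho_invFn_aux (u : QHeis n) (hu : u.rho ≠ 0) :
    (⟨-(u.rho⁻¹ • u.q), -((‖u.q‖ ^ 4 + ‖u.w‖ ^ 2)⁻¹ • u.w), by simp [u.re_w]⟩ : QHeis n).rho
      = u.rho⁻¹ := by
  have h0 : ‖u.rho‖ ≠ 0 := norm_ne_zero_iff.2 hu
  have hstar : star u.rho = ((‖u.q‖ ^ 2 : ℝ) : ℍ[ℝ]) + u.w := by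
    have h := u.re_w
    have : star u.w = -u.w := by ext <;> simp [h]
    rw [rho, star_sub, this, Quaternion.star_coe, sub_neg_eq_add]
  have hinv : u.rho⁻¹ = (‖u.rho‖ ^ 2)⁻¹ • star u.rho := by
    rw [Quaternion.inv_def, Quaternion.normSq_eq_norm_mul_self, sq]
  have hq : ‖u.rho⁻¹ • u.q‖ ^ 2 = (‖u.rho‖ ^ 2)⁻¹ * ‖u.q‖ ^ 2 := by
    rw [norm_smul, norm_inv]; ring
  rw [rho]
  dsimp only
  rw [norm_neg, hq, hinv, hstar, norm_rho_sq, smul_add, sub_neg_eq_add, Quaternion.coe_mul,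
    Quaternion.coe_mul_eq_smul]

theorem invFn_invFn (x : Option (QHeis n)) : invFn (invFn x) = x := by
  rcases x with _ | u
  · simp [invFn]
  · by_cases hu : u = 1
    · simp [invFn, hu]
    · have hr : u.rho ≠ 0 := fun h => hu (rho_eq_zero h)
      have hr' := rho_invFn_aux u hr
      have hN : ‖u.q‖ ^ 4 + ‖u.w‖ ^ 2 ≠ 0 := by
        rw [← norm_rho_sq]; exact pow_ne_zero 2 (norm_ne_zero_iff.2 hr)
      rw [invFn, if_neg hu]
      set v : QHeis n := ⟨-(u.rho⁻¹ • u.q), -((‖u.q‖ ^ 4 + ‖u.w‖ ^ 2)⁻¹ • u.w), by simp [u.re_w]⟩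
        with hv
      have hv1 : v ≠ 1 := by
        intro h
        rw [h, rho_one] at hr'
        exact inv_ne_zero hr hr'.symm
      have hNv : ‖v.q‖ ^ 4 + ‖v.w‖ ^ 2 = (‖u.q‖ ^ 4 + ‖u.w‖ ^ 2)⁻¹ := by
        rw [← norm_rho_sq, ← norm_rho_sq, hr', norm_inv, inv_pow]
      rw [invFn, if_neg hv1]
      congr 1
      apply QHeis.ext
      · change -(v.rho⁻¹ • v.q) = u.q
        rw [hr', inv_inv]
        change -(u.rho • -(u.rho⁻¹ • u.q)) = u.q
        rw [smul_neg, neg_neg, smul_inv_smul₀ hr]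
      · change -((‖v.q‖ ^ 4 + ‖v.w‖ ^ 2)⁻¹ • v.w) = u.w
        rw [hNv, inv_inv]
        change -((‖u.q‖ ^ 4 + ‖u.w‖ ^ 2) • -((‖u.q‖ ^ 4 + ‖u.w‖ ^ 2)⁻¹ • u.w)) = u.w
        rw [smul_neg, neg_neg, smul_inv_smul₀ hN]

/-- The inversion, as a permutation of `G ∪ {∞}`. -/
def inversion : Equiv.Perm (Option (QHeis n)) := ⟨invFn, invFn, invFn_invFn, invFn_invFn⟩

end QHeis

open QHeis

/-- The conformal group `Aut(G)`, acting on `G ∪ {∞}` (`∞` is `none`): all finite compositions of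
left translations, dilations, rotations (these fix `∞`) and the inversion, and their inverses. -/
def AutG (n : ℕ) : Subgroup (Equiv.Perm (Option (QHeis n))) :=
  Subgroup.closure
    ({σ | ∃ u : QHeis n, σ = (Equiv.mulLeft u).optionCongr} ∪
      {σ | ∃ (δ : ℝ) (hδ : 0 < δ), σ = (dilation δ hδ).optionCongr} ∪
      {σ | ∃ A : unitary (Matrix (Fin n) (Fin n) ℍ[ℝ]), σ = (rotation A).optionCongr} ∪
      {inversion})

/-! ### The quaternionic sphere and the Cayley transform -/

/-- The real inner product space `ℍⁿ × ℍ ≅ ℝ⁴ⁿ⁺⁴` with its Euclidean norm. -/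
abbrev QSpace (n : ℕ) : Type := WithLp 2 (EuclideanSpace ℍ[ℝ] (Fin n) × ℍ[ℝ])

instance : MeasurableSpace ℍ[ℝ] := borel _

instance : BorelSpace ℍ[ℝ] := ⟨rfl⟩

/-- The quaternionic sphere `S`. -/
abbrev QSphere (n : ℕ) : Type := Metric.sphere (0 : QSpace n) 1

/-- The quaternionic scalar product `ζ · η̄ = ∑ⱼ ζⱼ η̄ⱼ` on `ℍⁿ⁺¹ = ℍⁿ × ℍ`. -/
def sdot (ζ η : QSpace n) : ℍ[ℝ] := qdot ζ.fst η.fst + ζ.snd * star η.snd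

theorem sphere_norm_sq (ζ : QSphere n) : ‖ζ.1.fst‖ ^ 2 + ‖ζ.1.snd‖ ^ 2 = 1 := by
  rw [← WithLp.prod_norm_sq_eq_of_L2, norm_eq_of_mem_sphere, one_pow]

/-- The south pole `o = (0, …, 0, -1)`. -/
def southPole : QSphere n :=
  ⟨WithLp.toLp 2 (0, -1), by
    rw [mem_sphere_zero_iff_norm, ← sq_eq_sq₀ (norm_nonneg _) zero_le_one,
      WithLp.prod_norm_sq_eq_of_L2]
    simp⟩

theorem eq_southPole {ζ : QSphere n} (h : ζ.1.snd = -1) : ζ = southPole := by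
  have h1 := sphere_norm_sq ζ
  rw [h] at h1
  have h2 : ζ.1.fst = 0 := by simpa using h1
  apply Subtype.ext
  apply (WithLp.equiv 2 _).injective
  exact Prod.ext h2 h

theorem norm_one_add_sq (a : ℍ[ℝ]) : ‖1 + a‖ ^ 2 = 1 + 2 * a.re + ‖a‖ ^ 2 := by
  simp only [sq, ← Quaternion.normSq_eq_norm_mul_self, Quaternion.normSq_def']
  simp
  ring

theorem norm_one_sub_sq (a : ℍ[ℝ]) : ‖1 - a‖ ^ 2 = 1 - 2 * a.re + ‖a‖ ^ 2 := by
  simp only [sq, ← Quaternion.normSq_eq_norm_mul_self, Quaternion.normSq_def']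
  simp
  ring

/-- The Cayley transform on `G`,
`(q, w) ↦ ((1 + |q|² - w)⁻¹ 2q, (1 + |q|² - w)⁻¹ (1 - |q|² + w))`; recall `u.rho = |q|² - w`. -/
def cayleyPt (u : QHeis n) : QSphere n :=
  ⟨WithLp.toLp 2 ((1 + u.rho)⁻¹ • ((2 : ℝ) • u.q), (1 + u.rho)⁻¹ * (1 - u.rho)), by
    have h0 : ‖1 + u.rho‖ ≠ 0 := norm_ne_zero_iff.2 u.one_add_rho_ne_zero
    have h1 := norm_one_add_sq u.rho
    have h2 := norm_one_sub_sq u.rho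
    rw [re_rho] at h1 h2
    rw [mem_sphere_zero_iff_norm, ← sq_eq_sq₀ (norm_nonneg _) zero_le_one,
      WithLp.prod_norm_sq_eq_of_L2]
    change ‖(1 + u.rho)⁻¹ • ((2 : ℝ) • u.q)‖ ^ 2 + ‖(1 + u.rho)⁻¹ * (1 - u.rho)‖ ^ 2 = _
    rw [norm_smul, norm_smul, norm_mul, norm_inv, mul_pow, mul_pow, mul_pow, Real.norm_ofNat,
      h2, ← mul_add, one_pow, inv_pow, inv_mul_eq_one₀ (pow_ne_zero 2 h0), h1]
    ring⟩

/-- The inverse Cayley transform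
`ζ ↦ ((1 + ζₙ₊₁)⁻¹ ζ', -Im ((1 + ζₙ₊₁)⁻¹ (1 - ζₙ₊₁)))` off the south pole. -/
def cayleyInvPt (ζ : QSphere n) : QHeis n :=
  ⟨(1 + ζ.1.snd)⁻¹ • ζ.1.fst, -((1 + ζ.1.snd)⁻¹ * (1 - ζ.1.snd)).im, by simp⟩

theorem quat_two_ne_zero : (2 : ℍ[ℝ]) ≠ 0 := by
  intro h
  have h1 : (1 + 1 : ℍ[ℝ]).re = (0 : ℍ[ℝ]).re := by rw [one_add_one_eq_two, h]
  simp at h1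

theorem cayley_aux (a : ℍ[ℝ]) (ha : 1 + a ≠ 0) :
    1 + (1 + a)⁻¹ * (1 - a) = 2 * (1 + a)⁻¹ := by
  have : (1 : ℍ[ℝ]) - a = 2 - (1 + a) := by rw [← one_add_one_eq_two]; abel
  rw [this, mul_sub, inv_mul_cancel₀ ha, add_sub_cancel]
  exact ((Commute.ofNat_left 2 _).eq).symm

theorem cayley_aux' (a : ℍ[ℝ]) (ha : 1 + a ≠ 0) :
    (1 + (1 + a)⁻¹ * (1 - a))⁻¹ * (1 - (1 + a)⁻¹ * (1 - a)) = a := by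
  have h2 : (2 : ℍ[ℝ]) ≠ 0 := quat_two_ne_zero
  have h1 : 1 - (1 + a)⁻¹ * (1 - a) = (1 + a)⁻¹ * (2 * a) := by
    have : (2 : ℍ[ℝ]) * a = (1 + a) - (1 - a) := by rw [two_mul]; abel
    rw [this, mul_sub (1 + a)⁻¹ (1 + a), inv_mul_cancel₀ ha]
  rw [cayley_aux a ha, h1, mul_inv_rev, inv_inv]
  have hc : Commute (2 : ℍ[ℝ])⁻¹ (1 + a)⁻¹ := ((Commute.ofNat_left 2 (1 + a)).inv_left₀).inv_right₀
  rw [mul_assoc, ← mul_assoc (2 : ℍ[ℝ])⁻¹, hc.eq, mul_assoc, inv_mul_cancel_left₀ h2,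
    mul_inv_cancel_left₀ ha]

theorem cayleyPt_snd_ne (u : QHeis n) : (cayleyPt u).1.snd ≠ -1 := by
  intro h
  have h1 : (1 + u.rho)⁻¹ * (1 - u.rho) = -1 := h
  have h2 := cayley_aux u.rho u.one_add_rho_ne_zero
  rw [h1] at h2
  exact mul_ne_zero quat_two_ne_zero (inv_ne_zero u.one_add_rho_ne_zero) (by rw [← h2]; abel)

theorem one_add_ne_zero_of_ne {a : ℍ[ℝ]} (h : a ≠ -1) : 1 + a ≠ 0 := fun h' =>
  h (eq_neg_of_add_eq_zero_right h')

theorem cayleyInvPt_cayleyPt (u : QHeis n) : cayleyInvPt (cayleyPt u) = u := by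
  have hu := u.one_add_rho_ne_zero
  have hs : (cayleyPt u).1.snd = (1 + u.rho)⁻¹ * (1 - u.rho) := rfl
  have hf : (cayleyPt u).1.fst = (1 + u.rho)⁻¹ • ((2 : ℝ) • u.q) := rfl
  apply QHeis.ext
  · change (1 + (cayleyPt u).1.snd)⁻¹ • (cayleyPt u).1.fst = u.q
    have h2q : (2 : ℝ) • u.q = (2 : ℍ[ℝ]) • u.q := by
      rw [two_smul, two_smul]
    rw [hs, hf, cayley_aux _ hu, h2q, smul_smul, smul_smul, mul_assoc,
      ← (Commute.ofNat_left 2 (1 + u.rho)⁻¹).eq, inv_mul_cancel₀, one_smul]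
    exact mul_ne_zero quat_two_ne_zero (inv_ne_zero hu)
  · change -((1 + (cayleyPt u).1.snd)⁻¹ * (1 - (cayleyPt u).1.snd)).im = u.w
    rw [hs, cayley_aux' _ hu, im_rho, neg_neg]

theorem rho_cayleyInvPt (ζ : QSphere n) (hζ : ζ.1.snd ≠ -1) :
    (cayleyInvPt ζ).rho = (1 + ζ.1.snd)⁻¹ * (1 - ζ.1.snd) := by
  have ha := one_add_ne_zero_of_ne hζ
  have hn := sphere_norm_sq ζ
  set a := ζ.1.snd with hadef
  have hN : ‖1 + a‖ ^ 2 ≠ 0 := pow_ne_zero 2 (norm_ne_zero_iff.2 ha)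
  have hre : ((1 + a)⁻¹ * (1 - a)).re = ‖(cayleyInvPt ζ).q‖ ^ 2 := by
    change _ = ‖(1 + a)⁻¹ • ζ.1.fst‖ ^ 2
    rw [norm_smul, norm_inv, mul_pow, inv_pow, eq_sub_of_add_eq hn, Quaternion.inv_def,
      Quaternion.normSq_eq_norm_mul_self, ← sq, smul_mul_assoc, Quaternion.re_smul, smul_eq_mul]
    congr 1
    rw [sq, ← Quaternion.normSq_eq_norm_mul_self, Quaternion.normSq_def']
    simp
    ring
  rw [← Quaternion.re_add_im ((1 + a)⁻¹ * (1 - a)), hre, rho]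
  change _ - -((1 + a)⁻¹ * (1 - a)).im = _
  rw [sub_neg_eq_add]

theorem cayleyPt_cayleyInvPt (ζ : QSphere n) (hζ : ζ.1.snd ≠ -1) :
    cayleyPt (cayleyInvPt ζ) = ζ := by
  have ha := one_add_ne_zero_of_ne hζ
  have hr := rho_cayleyInvPt ζ hζ
  apply Subtype.ext
  apply (WithLp.equiv 2 _).injective
  refine Prod.ext ?_ ?_
  · change (1 + (cayleyInvPt ζ).rho)⁻¹ • ((2 : ℝ) • ((1 + ζ.1.snd)⁻¹ • ζ.1.fst)) = ζ.1.fst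
    have h2q : ∀ x : EuclideanSpace ℍ[ℝ] (Fin n), (2 : ℝ) • x = (2 : ℍ[ℝ]) • x := fun x => by
      rw [two_smul, two_smul]
    rw [hr, cayley_aux _ ha, h2q, smul_smul (2 : ℍ[ℝ]), inv_smul_smul₀]
    exact mul_ne_zero quat_two_ne_zero (inv_ne_zero ha)
  · change (1 + (cayleyInvPt ζ).rho)⁻¹ * (1 - (cayleyInvPt ζ).rho) = ζ.1.snd
    rw [hr, cayley_aux' _ ha]

open Classical in
/-- The Cayley transform as a bijection of `G ∪ {∞}` onto `S`, sending `∞` to the south pole. -/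
def cayley : Option (QHeis n) ≃ QSphere n where
  toFun x := x.elim southPole cayleyPt
  invFun ζ := if ζ.1.snd = -1 then none else some (cayleyInvPt ζ)
  left_inv x := by
    rcases x with _ | u
    · exact if_pos rfl
    · exact (if_neg (cayleyPt_snd_ne u)).trans (congrArg some (cayleyInvPt_cayleyPt u))
  right_inv ζ := by
    by_cases h : ζ.1.snd = -1
    · simp only [if_pos h, Option.elim_none]
      exact (eq_southPole h).symm
    · simp only [if_neg h, Option.elim_some]
      exact cayleyPt_cayleyInvPt ζ h

/-- The conformal transformations of `S`:
`Aut(S) = {C ∘ σ ∘ C⁻¹ : σ ∈ Aut(G)}` with `C` the Cayley transform. -/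
def AutS (n : ℕ) : Set (Equiv.Perm (QSphere n)) :=
  {τ | ∃ σ ∈ AutG n, τ = (cayley.symm.trans σ).trans cayley}

/-! ### Surface measure and Jacobians -/

/-- The Lebesgue surface measure `dζ` on `S`. -/
def sigma (n : ℕ) : Measure (QSphere n) := (volume : Measure (QSpace n)).toSphere

open Classical in
/-- The positively homogeneous extension `x ↦ |x| τ(x / |x|)` (`0 ↦ 0`) of a map `τ : S → S`. -/
def homExt (τ : QSphere n → QSphere n) (x : QSpace n) : QSpace n :=
  if hx : x = 0 then 0 else
    ‖x‖ • (τ ⟨‖x‖⁻¹ • x, by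
      rw [mem_sphere_zero_iff_norm, norm_smul, norm_inv, norm_norm,
        inv_mul_cancel₀ (norm_ne_zero_iff.2 hx)]⟩ : QSpace n)

/-- The Jacobian determinant `|J_τ(ζ)|` of `τ : S → S` with respect to the surface measure.
The derivative at `ζ ∈ S` of the homogeneous extension maps `ζ` to `τ ζ` and restricts to
`dτ : T_ζ S → T_{τ ζ} S`, so its determinant has the absolute value `|det dτ(ζ)|`. -/
def jac (τ : QSphere n → QSphere n) (ζ : QSphere n) : ℝ :=
  |(fderiv ℝ (homExt τ) (ζ : QSpace n)).det|

/-! ### The Hardy–Littlewood–Sobolev inequality on the sphere -/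

/-- The homogeneous dimension `Q = 4n + 6`. -/
def hdim (n : ℕ) : ℝ := 4 * n + 6

/-- The exponent `p = 2Q / (2Q - λ)`. -/
def pExp (n : ℕ) (lam : ℝ) : ℝ := 2 * hdim n / (2 * hdim n - lam)

/-- The sphere distance `d_S(ζ, η) = 2^{-1/2} |1 - ζ · η̄|^{1/2}`. -/
def dS (ζ η : QSphere n) : ℝ := (Real.sqrt 2)⁻¹ * Real.sqrt ‖1 - sdot ζ.1 η.1‖

/-- `f ∈ L^p(S)`. -/
def InLp (lam : ℝ) (f : QSphere n → ℂ) : Prop :=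
  MemLp f (ENNReal.ofReal (pExp n lam)) (sigma n)

/-- `‖f‖_p`. -/
def lpNorm (lam : ℝ) (f : QSphere n → ℂ) : ℝ :=
  (eLpNorm f (ENNReal.ofReal (pExp n lam)) (sigma n)).toReal

/-- The integrand `conj (f ζ) g(η) d_S(ζ, η)^{-λ}`. -/
def hlsIntegrand (lam : ℝ) (f g : QSphere n → ℂ) (x : QSphere n × QSphere n) : ℂ :=
  conj (f x.1) * g x.2 / ((dS x.1 x.2 ^ lam : ℝ) : ℂ)

/-- The double integral on the left side of the HLS inequality. -/
def hlsForm (lam : ℝ) (f g : QSphere n → ℂ) : ℂ :=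
  ∫ x, hlsIntegrand lam f g x ∂((sigma n).prod (sigma n))

/-- The HLS inequality on `S` holds with the constant `K`: for all `f, g ∈ L^p(S)` the double
integral converges absolutely and is at most `K ‖f‖_p ‖g‖_p` in absolute value. -/
def HLSHolds (n : ℕ) (lam K : ℝ) : Prop :=
  ∀ f g : QSphere n → ℂ, InLp lam f → InLp lam g →
    Integrable (hlsIntegrand lam f g) ((sigma n).prod (sigma n)) ∧
      ‖hlsForm lam f g‖ ≤ K * lpNorm lam f * lpNorm lam g

/-- `K` is the sharp (smallest) constant in the HLS inequality on `S`. -/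
def IsSharpConst (n : ℕ) (lam K : ℝ) : Prop := IsLeast {K' | HLSHolds n lam K'} K

/-- `f` is an extremizer: `0 ≠ f ∈ L^p(S)`, and the sharp HLS inequality is an equality for the
pair `(f, f)`. -/
def IsExtremizer (lam : ℝ) (f : QSphere n → ℂ) : Prop :=
  InLp lam f ∧ ¬ f =ᵐ[sigma n] 0 ∧
    ∃ K, IsSharpConst n lam K ∧ ‖hlsForm lam f f‖ = K * lpNorm lam f * lpNorm lam f

/-- `h` is a positive extremizer (positivity is meant almost everywhere). -/
def IsPosExtremizer (lam : ℝ) (h : QSphere n → ℝ) : Prop :=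
  (∀ᵐ ζ ∂(sigma n), 0 < h ζ) ∧ IsExtremizer lam (fun ζ => (h ζ : ℂ))

/-- `h̃ = |J_{γ⁻¹}|^{1/p} h ∘ γ⁻¹`. -/
def conformalTransform (lam : ℝ) (γ : Equiv.Perm (QSphere n)) (h : QSphere n → ℝ)
    (ζ : QSphere n) : ℝ :=
  jac γ.symm ζ ^ (1 / pExp n lam) * h (γ.symm ζ)

end QuatHLS

end

noncomputable section

namespace QuatHLS

open MeasureTheory
open scoped Quaternion ComplexConjugate

variable {n : ℕ}

/-! ### Siegel domain coordinates -/

/-! The center-mass condition is the critical point equation of a potential, in the manner of a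
conformal barycenter. The measure `μ = h ^ p dσ` is finite and has no atoms. On the open unit ball
let `Φ(z)` be the `μ`-integral of `log (|1 - z · ζ̄|² / (1 - |z|²))`. Then `Φ(0) = 0`, and `Φ` is
positive near every boundary point because no point carries mass (`potential_pos_near_boundary`); so
`Φ` attains its minimum at some `z₀` in the ball.

Translations and dilations of `G` act on the Siegel domain by real affine maps, hence on the ball
through the Cayley transform, and they act transitively. If `τ` is the one taking `z₀` to the
origin, the kernel obeys a cocycle law (`exists_poisson_cocycle`), so the potential of `τ_* μ` is
that of `μ` up to the change of variable and the constant `Φ(z₀)`. It is therefore nonnegative, and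
expanding it to first order at the origin gives `∫ τ(ζ) dμ = 0`
(`integral_coe_eq_zero_of_potential_nonneg`).

With `γ = τ` this integral is the center of mass of `h̃ ^ p`. That `h̃` is again an extremizer is
conformal invariance: `|1 - ζ · η̄|` is multiplied by `c(ζ) c(η)` with `c = confFactor`, while the
Jacobian is `c ^ Q` (`jac_sphereMap`), and `Q / p + λ / 2 = Q`. Rotations and the inversion are
never needed, so every map in play fixes the south pole, a null set, and is smooth elsewhere. -/

theorem qdot_smul_left (c : ℍ[ℝ]) (a b : EuclideanSpace ℍ[ℝ] (Fin n)) :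
    qdot (c • a) b = c * qdot a b := by
  simp [qdot, Finset.mul_sum, mul_assoc]

theorem qdot_smul_right (c : ℍ[ℝ]) (a b : EuclideanSpace ℍ[ℝ] (Fin n)) :
    qdot a (c • b) = qdot a b * star c := by
  simp [qdot, Finset.sum_mul, mul_assoc]

theorem qdot_real_smul_left (c : ℝ) (a b : EuclideanSpace ℍ[ℝ] (Fin n)) :
    qdot (c • a) b = c • qdot a b := by
  simp [qdot, Finset.smul_sum]

theorem qdot_real_smul_right (c : ℝ) (a b : EuclideanSpace ℍ[ℝ] (Fin n)) :
    qdot a (c • b) = c • qdot a b := by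
  simp [qdot, Finset.smul_sum]

theorem star_qdot (a b : EuclideanSpace ℍ[ℝ] (Fin n)) : star (qdot a b) = qdot b a := by
  simp [qdot]

theorem sdot_self (x : QSpace n) : sdot x x = ((‖x‖ ^ 2 : ℝ) : ℍ[ℝ]) := by
  rw [sdot, qdot_self, Quaternion.self_mul_star, Quaternion.normSq_eq_norm_mul_self, ← sq,
    ← Quaternion.coe_add, WithLp.prod_norm_sq_eq_of_L2]

/-- The sesquilinear kernel `r + s̄ - 2 q · q̄'` of the Siegel domain `{Re r > |q|²}`. -/
def siegelKernel (X Y : QSpace n) : ℍ[ℝ] :=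
  X.snd + star Y.snd - (2 : ℝ) • qdot X.fst Y.fst

/-- The defining function `Re r - |q|²` of the Siegel domain. -/
def height (X : QSpace n) : ℝ := X.snd.re - ‖X.fst‖ ^ 2

/-- The Cayley transform from the Siegel domain to the unit ball. -/
def cay (X : QSpace n) : QSpace n :=
  WithLp.toLp 2 ((1 + X.snd)⁻¹ • ((2 : ℝ) • X.fst), (1 + X.snd)⁻¹ * (1 - X.snd))

/-- The Cayley transform from the unit ball to the Siegel domain. -/
def cayInv (X : QSpace n) : QSpace n :=
  WithLp.toLp 2 ((1 + X.snd)⁻¹ • X.fst, (1 + X.snd)⁻¹ * (1 - X.snd))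

/-- The boundary point of the Siegel domain given by an element of the Heisenberg group. -/
def siegelPt (u : QHeis n) : QSpace n := WithLp.toLp 2 (u.q, u.rho)

/-- The affine action of a left translation followed by a dilation. -/
def affineMap (δ : ℝ) (v : QHeis n) (X : QSpace n) : QSpace n :=
  WithLp.toLp 2 (δ • (v.q + X.fst), δ ^ 2 • (X.snd + v.rho + (2 : ℝ) • qdot X.fst v.q))

/-- A left translation followed by a dilation. -/
def transDil (δ : ℝ) (hδ : 0 < δ) (v : QHeis n) : Equiv.Perm (QHeis n) :=
  (Equiv.mulLeft v).trans (QHeis.dilation δ hδ)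

theorem star_rho (v : QHeis n) : star v.rho = ((‖v.q‖ ^ 2 : ℝ) : ℍ[ℝ]) + v.w := by
  have h := v.re_w
  have : star v.w = -v.w := by ext <;> simp [h]
  rw [QHeis.rho, star_sub, this, Quaternion.star_coe, sub_neg_eq_add]

/-- By polarization `|q + q'|² - 2 Im (q · q̄')` equals `|q|² + |q'|² + 2 q' · q̄`, since
subtracting the imaginary part conjugates. The action is thus real affine in `(q, r)`, which lets it
extend from the boundary to the whole Siegel domain. -/
theorem siegelPt_transDil (δ : ℝ) (hδ : 0 < δ) (v u : QHeis n) :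
    siegelPt (transDil δ hδ v u) = affineMap δ v (siegelPt u) := by
  have hz : ((‖v.q + u.q‖ ^ 2 : ℝ) : ℍ[ℝ]) - (v.w + u.w + (2 : ℝ) • (qdot v.q u.q).im)
      = u.rho + v.rho + (2 : ℝ) • qdot u.q v.q := by
    rw [← qdot_self, qdot_add_left, qdot_add_right, qdot_add_right, qdot_self, qdot_self,
      ← star_qdot v.q u.q, QHeis.rho, QHeis.rho]
    ext <;> simp <;> ring
  have hq : ‖δ • (v.q + u.q)‖ ^ 2 = δ ^ 2 * ‖v.q + u.q‖ ^ 2 := by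
    rw [norm_smul, mul_pow, Real.norm_eq_abs, sq_abs]
  apply (WithLp.equiv 2 _).injective
  refine Prod.ext rfl ?_
  change ((‖δ • (v.q + u.q)‖ ^ 2 : ℝ) : ℍ[ℝ]) - δ ^ 2 • (v.w + u.w + (2 : ℝ) • (qdot v.q u.q).im)
      = δ ^ 2 • (u.rho + v.rho + (2 : ℝ) • qdot u.q v.q)
  rw [hq, Quaternion.coe_mul, Quaternion.coe_mul_eq_smul, ← smul_sub, hz]

theorem cayInv_eq_siegelPt (ζ : QSphere n) (hζ : ζ.1.snd ≠ -1) :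
    cayInv ζ.1 = siegelPt (cayleyInvPt ζ) := by
  apply (WithLp.equiv 2 _).injective
  exact Prod.ext rfl (rho_cayleyInvPt ζ hζ).symm

/-- Everything follows from `(1 + r)(1 + s̄) - (1 - r)(1 - s̄) = 2 (r + s̄)`. Noncommutativity is
harmless because the inverse factors stay on the outer sides. -/
theorem one_sub_sdot_cay (X Y : QSpace n) (hX : 1 + X.snd ≠ 0) (hY : 1 + Y.snd ≠ 0) :
    1 - sdot (cay X) (cay Y) =
      (1 + X.snd)⁻¹ * ((2 : ℝ) • siegelKernel X Y) * star (1 + Y.snd)⁻¹ := by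
  have h1 : (1 : ℍ[ℝ]) =
      (1 + X.snd)⁻¹ * ((1 + X.snd) * star (1 + Y.snd)) * star (1 + Y.snd)⁻¹ := by
    rw [inv_mul_cancel_left₀ hX, ← star_mul, inv_mul_cancel₀ hY, star_one]
  have h2 : sdot (cay X) (cay Y) = (1 + X.snd)⁻¹ *
      ((4 : ℝ) • qdot X.fst Y.fst + (1 - X.snd) * star (1 - Y.snd)) * star (1 + Y.snd)⁻¹ := by
    change qdot ((1 + X.snd)⁻¹ • ((2 : ℝ) • X.fst)) ((1 + Y.snd)⁻¹ • ((2 : ℝ) • Y.fst)) +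
      (1 + X.snd)⁻¹ * (1 - X.snd) * star ((1 + Y.snd)⁻¹ * (1 - Y.snd)) = _
    rw [qdot_smul_left, qdot_smul_right, qdot_real_smul_left, qdot_real_smul_right, smul_smul,
      star_mul]
    norm_num
    noncomm_ring
  rw [h2]
  nth_rw 1 [h1]
  rw [← sub_mul, ← mul_sub, siegelKernel]
  congr 2
  ext <;> simp <;> ring

theorem siegelKernel_affineMap (δ : ℝ) (v : QHeis n) (X Y : QSpace n) :
    siegelKernel (affineMap δ v X) (affineMap δ v Y) = δ ^ 2 • siegelKernel X Y := by
  change δ ^ 2 • (X.snd + v.rho + (2 : ℝ) • qdot X.fst v.q) +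
    star (δ ^ 2 • (Y.snd + v.rho + (2 : ℝ) • qdot Y.fst v.q)) -
    (2 : ℝ) • qdot (δ • (v.q + X.fst)) (δ • (v.q + Y.fst)) = _
  rw [qdot_real_smul_left, qdot_real_smul_right, qdot_add_left, qdot_add_right, qdot_add_right,
    qdot_self, siegelKernel, Quaternion.star_smul, star_add, star_add, star_rho,
    Quaternion.star_smul, star_qdot, QHeis.rho]
  ext <;> simp <;> ring

theorem siegelKernel_self (X : QSpace n) : siegelKernel X X = ((2 * height X : ℝ) : ℍ[ℝ]) := by
  rw [siegelKernel, qdot_self, height]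
  ext <;> simp <;> ring

/-- This is the diagonal case of the invariance of the kernel. -/
theorem height_affineMap (δ : ℝ) (v : QHeis n) (X : QSpace n) :
    height (affineMap δ v X) = δ ^ 2 * height X := by
  have h := siegelKernel_affineMap δ v X X
  rw [siegelKernel_self, siegelKernel_self, ← Quaternion.coe_mul_eq_smul, ← Quaternion.coe_mul,
    Quaternion.coe_inj] at h
  linarith

theorem one_sub_norm_cay_sq (X : QSpace n) (hX : 1 + X.snd ≠ 0) :
    1 - ‖cay X‖ ^ 2 = 4 * height X / ‖1 + X.snd‖ ^ 2 := by
  have h := one_sub_sdot_cay X X hX hX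
  rw [sdot_self, siegelKernel_self, Quaternion.smul_coe,
    (Quaternion.coe_commutes _ _).symm, mul_assoc, Quaternion.self_mul_star,
    Quaternion.normSq_eq_norm_mul_self, norm_inv, ← Quaternion.coe_mul] at h
  have h' := congrArg (fun a : ℍ[ℝ] => a.re) h
  simp only [Quaternion.re_sub, Quaternion.re_one, Quaternion.re_coe] at h'
  rw [h']
  have : ‖1 + X.snd‖ ≠ 0 := norm_ne_zero_iff.2 hX
  field_simp
  ring

theorem cay_snd_add (X : QSpace n) (hX : 1 + X.snd ≠ 0) :
    1 + (cay X).snd = 2 * (1 + X.snd)⁻¹ := cayley_aux _ hX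

theorem cayInv_snd_add (X : QSpace n) (hX : 1 + X.snd ≠ 0) :
    1 + (cayInv X).snd = 2 * (1 + X.snd)⁻¹ := cayley_aux _ hX

theorem two_smul_quat (x : EuclideanSpace ℍ[ℝ] (Fin n)) : (2 : ℝ) • x = (2 : ℍ[ℝ]) • x := by
  rw [two_smul, two_smul]

theorem cayInv_snd_add_ne_zero {X : QSpace n} (hX : 1 + X.snd ≠ 0) :
    1 + (cayInv X).snd ≠ 0 := by
  rw [cayInv_snd_add X hX]
  exact mul_ne_zero quat_two_ne_zero (inv_ne_zero hX)

theorem norm_quat_two : ‖(2 : ℍ[ℝ])‖ = 2 := by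
  have : (2 : ℍ[ℝ]) = ((2 : ℝ) : ℍ[ℝ]) := by norm_cast
  rw [this, Quaternion.norm_coe]; norm_num

theorem norm_cayInv_snd_add {X : QSpace n} (hX : 1 + X.snd ≠ 0) :
    ‖1 + (cayInv X).snd‖ = 2 / ‖1 + X.snd‖ := by
  rw [cayInv_snd_add X hX, norm_mul, norm_inv, norm_quat_two, div_eq_mul_inv]

theorem cay_cayInv (X : QSpace n) (hX : 1 + X.snd ≠ 0) : cay (cayInv X) = X := by
  apply (WithLp.equiv 2 _).injective
  refine Prod.ext ?_ ?_
  · change (1 + (cayInv X).snd)⁻¹ • ((2 : ℝ) • ((1 + X.snd)⁻¹ • X.fst)) = X.fst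
    rw [cayInv_snd_add _ hX, two_smul_quat, smul_smul (2 : ℍ[ℝ]), inv_smul_smul₀]
    exact mul_ne_zero quat_two_ne_zero (inv_ne_zero hX)
  · exact cayley_aux' _ hX

theorem cayInv_cay (X : QSpace n) (hX : 1 + X.snd ≠ 0) : cayInv (cay X) = X := by
  apply (WithLp.equiv 2 _).injective
  refine Prod.ext ?_ ?_
  · change (1 + (cay X).snd)⁻¹ • ((1 + X.snd)⁻¹ • ((2 : ℝ) • X.fst)) = X.fst
    rw [cay_snd_add _ hX, two_smul_quat, smul_smul, smul_smul, mul_assoc,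
      ← (Commute.ofNat_left 2 (1 + X.snd)⁻¹).eq, inv_mul_cancel₀, one_smul]
    exact mul_ne_zero quat_two_ne_zero (inv_ne_zero hX)
  · exact cayley_aux' _ hX

theorem norm_one_sub_sdot_cay (X Y : QSpace n) (hX : 1 + X.snd ≠ 0) (hY : 1 + Y.snd ≠ 0) :
    ‖1 - sdot (cay X) (cay Y)‖ =
      2 * ‖siegelKernel X Y‖ / (‖1 + X.snd‖ * ‖1 + Y.snd‖) := by
  rw [one_sub_sdot_cay X Y hX hY, norm_mul, norm_mul, norm_smul, norm_star, norm_inv, norm_inv,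
    Real.norm_ofNat]
  field_simp

theorem height_cayInv (X : QSpace n) (hX : 1 + X.snd ≠ 0) :
    height (cayInv X) = (1 - ‖X‖ ^ 2) / ‖1 + X.snd‖ ^ 2 := by
  have h := one_sub_norm_cay_sq (cayInv X) (cayInv_snd_add_ne_zero hX)
  rw [cay_cayInv X hX, norm_cayInv_snd_add hX] at h
  have : ‖1 + X.snd‖ ≠ 0 := norm_ne_zero_iff.2 hX
  rw [h]
  field_simp
  ring

/-- Dilations are group automorphisms, so in the inverse, which dilates first, the translation can
be moved past the dilation at the cost of replacing `v⁻¹` by its dilate. -/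
theorem transDil_symm (δ : ℝ) (hδ : 0 < δ) (v : QHeis n) :
    ∃ v' : QHeis n, (transDil δ hδ v).symm = transDil δ⁻¹ (inv_pos.2 hδ) v' := by
  refine ⟨QHeis.dilation δ hδ v⁻¹, ?_⟩
  have hmul : ∀ a b : QHeis n, QHeis.dilation δ hδ (a * b) =
      QHeis.dilation δ hδ a * QHeis.dilation δ hδ b := by
    intro a b
    apply QHeis.ext
    · exact smul_add _ _ _
    · change δ ^ 2 • (a.w + b.w + (2 : ℝ) • (qdot a.q b.q).im) =
        δ ^ 2 • a.w + δ ^ 2 • b.w + (2 : ℝ) • (qdot (δ • a.q) (δ • b.q)).im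
      rw [qdot_real_smul_left, qdot_real_smul_right, smul_smul, Quaternion.im_smul, smul_add,
        smul_add, smul_comm, sq]
  have hinv : ∀ a : QHeis n, QHeis.dilation δ⁻¹ (inv_pos.2 hδ) a =
      (QHeis.dilation δ hδ).symm a := by
    intro a
    apply QHeis.ext
    · rfl
    · change δ⁻¹ ^ 2 • a.w = (δ ^ 2)⁻¹ • a.w
      rw [inv_pow]
  ext1 u
  rw [Equiv.symm_apply_eq]
  change u = QHeis.dilation δ hδ (v * QHeis.dilation δ⁻¹ (inv_pos.2 hδ)
    (QHeis.dilation δ hδ v⁻¹ * u))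
  have hone : QHeis.dilation δ hδ (1 : QHeis n) = 1 := by
    apply QHeis.ext
    · exact smul_zero _
    · exact smul_zero _
  rw [hinv, hmul, Equiv.apply_symm_apply, ← mul_assoc, ← hmul, mul_inv_cancel, hone, one_mul]

/-- Every point of the Siegel domain is moved to the base point by a translation and a dilation. -/
theorem exists_affineMap_eq_base (Y : QSpace n) (hY : 0 < height Y) :
    ∃ (δ : ℝ) (_ : 0 < δ) (v : QHeis n), affineMap δ v Y = WithLp.toLp 2 (0, 1) := by
  -- Translating by `-q` with central coordinate `Im r` leaves `(0, Re r - |q|²)`, a positive real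
  -- height, which the dilation normalizes to `1`.
  refine ⟨(Real.sqrt (height Y))⁻¹, inv_pos.2 (Real.sqrt_pos.2 hY),
    ⟨-Y.fst, Y.snd.im, by simp⟩, ?_⟩
  apply (WithLp.equiv 2 _).injective
  refine Prod.ext ?_ ?_
  · change _ • (-Y.fst + Y.fst) = 0
    simp
  · change (Real.sqrt (height Y))⁻¹ ^ 2 • (Y.snd + (((‖-Y.fst‖ ^ 2 : ℝ) : ℍ[ℝ]) - Y.snd.im) +
      (2 : ℝ) • qdot Y.fst (-Y.fst)) = 1
    rw [inv_pow, Real.sq_sqrt hY.le, ← neg_one_smul ℝ Y.fst, qdot_real_smul_right, qdot_self,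
      inv_smul_eq_iff₀ hY.ne', height, norm_smul, norm_neg, norm_one, one_mul]
    generalize ‖Y.fst‖ ^ 2 = m
    ext <;> simp <;> ring

theorem affineMap_surjective {δ : ℝ} (hδ : 0 < δ) (v : QHeis n) (Z : QSpace n) :
    ∃ Y, affineMap δ v Y = Z := by
  refine ⟨WithLp.toLp 2 (δ⁻¹ • Z.fst - v.q, (δ ^ 2)⁻¹ • Z.snd - v.rho -
    (2 : ℝ) • qdot (δ⁻¹ • Z.fst - v.q) v.q), ?_⟩
  apply (WithLp.equiv 2 _).injective
  refine Prod.ext ?_ ?_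
  · change δ • (v.q + (δ⁻¹ • Z.fst - v.q)) = Z.fst
    rw [add_sub_cancel, smul_inv_smul₀ hδ.ne']
  · change δ ^ 2 • ((δ ^ 2)⁻¹ • Z.snd - v.rho -
      (2 : ℝ) • qdot (δ⁻¹ • Z.fst - v.q) v.q + v.rho +
      (2 : ℝ) • qdot (δ⁻¹ • Z.fst - v.q) v.q) = Z.snd
    rw [sub_sub, add_assoc, sub_add_cancel, smul_inv_smul₀ (pow_ne_zero 2 hδ.ne')]

instance : ContinuousSMul ℝ (QSpace n) := IsBoundedSMul.continuousSMul

/-! ### Determinants -/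

/-- The relation `D N = 2 N D` says that `D` conjugates `1 + N` to `1 + 2 N = (1 + N)²`. The
determinant of `1 + N` equals its own square, and it is nonzero because `1 - N` is an inverse. -/
theorem det_one_add_eq_one {E : Type*} [AddCommGroup E] [Module ℝ E]
    (N D : Module.End ℝ E) (hN : N * N = 0) (hD : LinearMap.det D ≠ 0)
    (h : D * N = (2 : ℝ) • (N * D)) : LinearMap.det (1 + N) = 1 := by
  have h1 : D * (1 + N) = (1 + N) * ((1 + N) * D) := by
    have : (1 + N) * ((1 + N) * D) = D + (2 : ℝ) • (N * D) + N * N * D := by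
      rw [two_smul]; noncomm_ring
    rw [this, hN, mul_add, h]
    simp
  have h2 : (1 + N) * (1 - N) = 1 := by
    have : (1 + N) * (1 - N) = 1 - N * N := by noncomm_ring
    rw [this, hN, sub_zero]
  have h3 := congrArg LinearMap.det h1
  have h4 := congrArg LinearMap.det h2
  rw [map_mul, map_mul, map_mul] at h3
  rw [map_mul, map_one] at h4
  have h5 : LinearMap.det (1 + N) ≠ 0 := left_ne_zero_of_mul_eq_one h4
  have h6 : LinearMap.det (1 + N) * LinearMap.det D * (LinearMap.det (1 + N) - 1) = 0 := by
    linear_combination -h3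
  simpa [h5, hD, sub_eq_zero] using h6

theorem abs_det_of_norm {E : Type*} [NormedAddCommGroup E] [InnerProductSpace ℝ E]
    [FiniteDimensional ℝ E] (A : E →ₗ[ℝ] E) (c : ℝ) (hc : 0 < c) (hA : ∀ x, ‖A x‖ = c * ‖x‖) :
    |LinearMap.det A| = c ^ Module.finrank ℝ E := by
  let I : E →ₗᵢ[ℝ] E := ⟨c⁻¹ • A, fun x => by
    rw [LinearMap.smul_apply, norm_smul, hA, norm_inv, Real.norm_of_nonneg hc.le,
      inv_mul_cancel_left₀ hc.ne']⟩
  have h : A = c • I.toLinearMap := (smul_inv_smul₀ hc.ne' A).symm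
  rw [← LinearMap.normDet_eq_abs_det, h, LinearMap.normDet_smul, I.normDet_eq_one, mul_one,
    Real.norm_of_nonneg hc.le]

section Triangular

variable {E F : Type*} [NormedAddCommGroup E] [InnerProductSpace ℝ E] [FiniteDimensional ℝ E]
  [NormedAddCommGroup F] [InnerProductSpace ℝ F] [FiniteDimensional ℝ F]

theorem det_withLp_conj {E F : Type*} [NormedAddCommGroup E] [InnerProductSpace ℝ E]
    [NormedAddCommGroup F] [InnerProductSpace ℝ F] (T : WithLp 2 (E × F) →ₗ[ℝ] WithLp 2 (E × F)) (S : Module.End ℝ (E × F))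
    (h : ∀ x, WithLp.ofLp (T x) = S (WithLp.ofLp x)) : LinearMap.det T = LinearMap.det S := by
  rw [← LinearMap.det_conj T (WithLp.linearEquiv 2 ℝ (E × F))]
  congr 1
  ext1 <;> ext1 x <;> exact h _

theorem det_prodMap_smul_ne_zero (a b : ℝ) (ha : a ≠ 0) (hb : b ≠ 0) :
    LinearMap.det (LinearMap.prodMap (a • (1 : Module.End ℝ E)) (b • (1 : Module.End ℝ F))) ≠ 0 := by
  rw [LinearMap.det_prodMap, LinearMap.det_smul, LinearMap.det_smul, map_one, map_one]
  positivity

/-- The map factors as a block diagonal map times `1 + N` with `N` off-diagonal. Doubling one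
summand provides the conjugating map of `det_one_add_eq_one`. -/
theorem det_upper_triangular (T : WithLp 2 (E × F) →ₗ[ℝ] WithLp 2 (E × F))
    (A : E →ₗ[ℝ] E) (B : F →ₗ[ℝ] F) (M : F →ₗ[ℝ] E)
    (hT : ∀ x, T x = WithLp.toLp 2 (A (x.fst + M x.snd), B x.snd)) :
    LinearMap.det T = LinearMap.det A * LinearMap.det B := by
  let N : Module.End ℝ (E × F) := LinearMap.inl ℝ E F ∘ₗ M ∘ₗ LinearMap.snd ℝ E F
  have hN : LinearMap.det (1 + N) = 1 := by
    refine det_one_add_eq_one N _ ?_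
      (det_prodMap_smul_ne_zero (E := E) (F := F) 2 1 two_ne_zero one_ne_zero) ?_
    · ext x <;> simp [N]
    · ext x <;> simp [N]
  rw [det_withLp_conj T (LinearMap.prodMap A B * (1 + N)) (fun x => by rw [hT]; simp [N]),
    map_mul, hN, mul_one, LinearMap.det_prodMap]

theorem det_lower_triangular (T : WithLp 2 (E × F) →ₗ[ℝ] WithLp 2 (E × F))
    (A : E →ₗ[ℝ] E) (B : F →ₗ[ℝ] F) (M : E →ₗ[ℝ] F)
    (hT : ∀ x, T x = WithLp.toLp 2 (A x.fst, B (x.snd + M x.fst))) :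
    LinearMap.det T = LinearMap.det A * LinearMap.det B := by
  let N : Module.End ℝ (E × F) := LinearMap.inr ℝ E F ∘ₗ M ∘ₗ LinearMap.fst ℝ E F
  have hN : LinearMap.det (1 + N) = 1 := by
    refine det_one_add_eq_one N _ ?_
      (det_prodMap_smul_ne_zero (E := E) (F := F) 1 2 one_ne_zero two_ne_zero) ?_
    · ext x <;> simp [N]
    · ext x <;> simp [N]
  rw [det_withLp_conj T (LinearMap.prodMap A B * (1 + N)) (fun x => by rw [hT]; simp [N]),
    map_mul, hN, mul_one, LinearMap.det_prodMap]

end Triangular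

/-- The perturbed map agrees with `A` on the complement of `x` and sends `x` to `y`. It is `A`
composed with a transvection of determinant `⟨x, A⁻¹ y⟩`, and the hypothesis at `w = A⁻¹ y` reads `1
= c ⟨x, A⁻¹ y⟩`. -/
theorem det_add_rank_one {E : Type*} [NormedAddCommGroup E] [InnerProductSpace ℝ E]
    [FiniteDimensional ℝ E] (A : E →L[ℝ] E) (hA : A.det ≠ 0) (x y : E) (c : ℝ)
    (hx : ‖x‖ = 1) (hy : ‖y‖ = 1) (h : ∀ w, inner ℝ y (A w) = c * inner ℝ x w) :
    (A + (innerSL ℝ x).smulRight (y - A x)).det * c = A.det := by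
  let e := LinearMap.equivOfDetNeZero (A : E →ₗ[ℝ] E) hA
  have he : ∀ w, A (e.symm w) = w := fun w => e.apply_symm_apply w
  have h1 : (A + (innerSL ℝ x).smulRight (y - A x) : E →L[ℝ] E).toLinearMap =
      (A : E →ₗ[ℝ] E) ∘ₗ LinearMap.transvection (innerSL ℝ x : E →L[ℝ] ℝ).toLinearMap
        (e.symm y - x) := by
    ext w
    simp [LinearMap.transvection.apply, he]
  have h2 := h (e.symm y)
  rw [he, real_inner_self_eq_norm_sq, hy] at h2
  rw [ContinuousLinearMap.det, h1, LinearMap.det_comp, LinearMap.transvection.det]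
  simp only [ContinuousLinearMap.coe_coe, innerSL_apply_apply, inner_sub_right,
    real_inner_self_eq_norm_sq, hx]
  rw [ContinuousLinearMap.det]
  linear_combination - (LinearMap.det (A : E →ₗ[ℝ] E)) * h2

theorem finrank_quatVec : Module.finrank ℝ (EuclideanSpace ℍ[ℝ] (Fin n)) = 4 * n := by
  rw [(WithLp.linearEquiv 2 ℝ (Fin n → ℍ[ℝ])).finrank_eq, Module.finrank_pi_fintype]
  simp [Quaternion.finrank_eq_four, mul_comm]

theorem finrank_qspace : Module.finrank ℝ (QSpace n) = 4 * n + 4 := by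
  rw [(WithLp.linearEquiv 2 ℝ (EuclideanSpace ℍ[ℝ] (Fin n) × ℍ[ℝ])).finrank_eq,
    Module.finrank_prod, finrank_quatVec, Quaternion.finrank_eq_four]

/-! ### Derivatives of the Cayley transform and of the affine action -/

/-- The common form of the Cayley transform and its inverse. -/
def fracMap (c : ℝ) (X : QSpace n) : QSpace n :=
  WithLp.toLp 2 ((1 + X.snd)⁻¹ • (c • X.fst), (1 + X.snd)⁻¹ * (1 - X.snd))

theorem cay_eq_fracMap : (cay : QSpace n → QSpace n) = fracMap 2 := rfl

theorem cayInv_eq_fracMap : (cayInv : QSpace n → QSpace n) = fracMap 1 := by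
  funext X
  rw [cayInv, fracMap, one_smul]

theorem hasFDerivAt_toLp {f : QSpace n → EuclideanSpace ℍ[ℝ] (Fin n)} {g : QSpace n → ℍ[ℝ]}
    {f' : QSpace n →L[ℝ] EuclideanSpace ℍ[ℝ] (Fin n)} {g' : QSpace n →L[ℝ] ℍ[ℝ]} {X : QSpace n}
    (hf : HasFDerivAt f f' X) (hg : HasFDerivAt g g' X) :
    HasFDerivAt (fun X => (WithLp.toLp 2 (f X, g X) : QSpace n))
      ((WithLp.prodContinuousLinearEquiv 2 ℝ (EuclideanSpace ℍ[ℝ] (Fin n)) ℍ[ℝ]).symm.toContinuousLinearMap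
        ∘L (f'.prod g')) X :=
  ((WithLp.prodContinuousLinearEquiv 2 ℝ (EuclideanSpace ℍ[ℝ] (Fin n))
    ℍ[ℝ]).symm.toContinuousLinearMap.hasFDerivAt).comp X (hf.prodMk hg)

theorem hasFDerivAt_fst (X : QSpace n) : HasFDerivAt (fun X : QSpace n => X.fst)
    (WithLp.fstL 2 ℝ (EuclideanSpace ℍ[ℝ] (Fin n)) ℍ[ℝ]) X :=
  (WithLp.fstL 2 ℝ (EuclideanSpace ℍ[ℝ] (Fin n)) ℍ[ℝ]).hasFDerivAt

theorem hasFDerivAt_snd (X : QSpace n) : HasFDerivAt (fun X : QSpace n => X.snd)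
    (WithLp.sndL 2 ℝ (EuclideanSpace ℍ[ℝ] (Fin n)) ℍ[ℝ]) X :=
  (WithLp.sndL 2 ℝ (EuclideanSpace ℍ[ℝ] (Fin n)) ℍ[ℝ]).hasFDerivAt

/-- Left multiplication by a quaternion on `ℍⁿ`, as a real linear map. -/
def smulLin (a : ℍ[ℝ]) : EuclideanSpace ℍ[ℝ] (Fin n) →ₗ[ℝ] EuclideanSpace ℍ[ℝ] (Fin n) where
  toFun x := a • x
  map_add' := smul_add a
  map_smul' c x := smul_comm a c x

/-- The map `y ↦ y • x`, as a real linear map. -/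
def smulRightLin (x : EuclideanSpace ℍ[ℝ] (Fin n)) : ℍ[ℝ] →ₗ[ℝ] EuclideanSpace ℍ[ℝ] (Fin n) where
  toFun a := a • x
  map_add' a b := add_smul a b x
  map_smul' c a := smul_assoc c a x

/-- The derivative is block triangular. Its diagonal blocks are quaternionic multiplications, hence
similarities, so their determinants are read off from norms: ratio `c / |1 + r|` on `ℝ⁴ⁿ` and `2 /
|1 + r|²` on `ℝ⁴`. -/
theorem exists_hasFDerivAt_fracMap (c : ℝ) (hc : 0 < c) (X : QSpace n) (hX : 1 + X.snd ≠ 0) :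
    ∃ A : QSpace n →L[ℝ] QSpace n, HasFDerivAt (fracMap c) A X ∧
      |A.det| = (c * ‖1 + X.snd‖⁻¹) ^ (4 * n) * (2 * ‖1 + X.snd‖⁻¹ ^ 2) ^ 4 := by
  have h1 : HasFDerivAt (fun X : QSpace n => (1 + X.snd)⁻¹) _ X :=
    (hasFDerivAt_inv' (𝕜 := ℝ) hX).comp X ((hasFDerivAt_snd X).const_add 1)
  have h2 := h1.fun_smul ((hasFDerivAt_fst X).const_smul c)
  have h3 := h1.mul' ((hasFDerivAt_snd X).const_sub 1)
  refine ⟨_, hasFDerivAt_toLp h2 h3, ?_⟩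
  set r := 1 + X.snd with hr
  have hr0 : 0 < ‖r⁻¹‖ := norm_pos_iff.2 (inv_ne_zero hX)
  let A : EuclideanSpace ℍ[ℝ] (Fin n) →ₗ[ℝ] EuclideanSpace ℍ[ℝ] (Fin n) := c • smulLin r⁻¹
  let B : ℍ[ℝ] →ₗ[ℝ] ℍ[ℝ] := (-2 : ℝ) • (LinearMap.mulLeftRight ℝ (r⁻¹, r⁻¹))
  let M : ℍ[ℝ] →ₗ[ℝ] EuclideanSpace ℍ[ℝ] (Fin n) := -smulRightLin (r⁻¹ • X.fst)
  have hA : |LinearMap.det A| = (c * ‖r⁻¹‖) ^ (4 * n) := by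
    rw [abs_det_of_norm A (c * ‖r⁻¹‖) (mul_pos hc hr0), finrank_quatVec]
    intro x
    change ‖c • (r⁻¹ • x)‖ = _
    rw [norm_smul, norm_smul, Real.norm_of_nonneg hc.le, mul_assoc]
  have hB : |LinearMap.det B| = (2 * ‖r⁻¹‖ ^ 2) ^ 4 := by
    rw [abs_det_of_norm B (2 * ‖r⁻¹‖ ^ 2) (by positivity), Quaternion.finrank_eq_four]
    intro x
    change ‖(-2 : ℝ) • (r⁻¹ * x * r⁻¹)‖ = _
    rw [norm_smul, norm_mul, norm_mul, norm_neg, Real.norm_ofNat]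
    ring
  rw [← norm_inv, ← hA, ← hB, ← abs_mul]
  congr 1
  refine det_upper_triangular _ A B M fun x => ?_
  apply (WithLp.equiv 2 _).injective
  refine Prod.ext ?_ ?_
  · change r⁻¹ • (c • x.fst) + (-(r⁻¹ * x.snd * r⁻¹)) • (c • X.fst) =
      c • (r⁻¹ • (x.fst + -(x.snd • (r⁻¹ • X.fst))))
    rw [smul_add, smul_add, smul_neg, smul_neg, neg_smul, mul_smul, mul_smul,
      smul_comm c, smul_comm c, smul_comm c, smul_comm c]
  · change r⁻¹ * (-x.snd) + (-(r⁻¹ * x.snd * r⁻¹)) * (1 - X.snd) = (-2 : ℝ) • (r⁻¹ * x.snd * r⁻¹)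
    have := cayley_aux X.snd hX
    have h4 : r⁻¹ * (-x.snd) + (-(r⁻¹ * x.snd * r⁻¹)) * (1 - X.snd) =
      - (r⁻¹ * x.snd * (1 + r⁻¹ * (1 - X.snd))) := by noncomm_ring
    rw [h4, hr, this, neg_smul, two_smul, two_mul, mul_add]

theorem exists_hasFDerivAt_affineMap (δ : ℝ) (hδ : 0 < δ) (v : QHeis n) (X : QSpace n) :
    ∃ A : QSpace n →L[ℝ] QSpace n, HasFDerivAt (affineMap δ v) A X ∧
      |A.det| = δ ^ (4 * n + 8) := by
  let ql : EuclideanSpace ℍ[ℝ] (Fin n) →ₗ[ℝ] ℍ[ℝ] :=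
    { toFun := fun x => qdot x v.q
      map_add' := fun a b => qdot_add_left a b _
      map_smul' := fun c a => qdot_real_smul_left c a _ }
  have h0 : HasFDerivAt (fun X : QSpace n => qdot X.fst v.q) _ X :=
    (ql.toContinuousLinearMap.hasFDerivAt).comp X (hasFDerivAt_fst X)
  have h1 := ((hasFDerivAt_fst X).const_add v.q).const_smul δ
  have h2 := (((hasFDerivAt_snd X).add_const v.rho).add (h0.const_smul (2 : ℝ))).const_smul (δ ^ 2)
  refine ⟨_, hasFDerivAt_toLp h1 h2, ?_⟩
  let A : EuclideanSpace ℍ[ℝ] (Fin n) →ₗ[ℝ] EuclideanSpace ℍ[ℝ] (Fin n) := δ • LinearMap.id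
  let B : ℍ[ℝ] →ₗ[ℝ] ℍ[ℝ] := (δ ^ 2) • LinearMap.id
  have h3 : LinearMap.det A * LinearMap.det B = δ ^ (4 * n + 8) := by
    rw [LinearMap.det_smul, LinearMap.det_smul, LinearMap.det_id, LinearMap.det_id,
      finrank_quatVec, Quaternion.finrank_eq_four]
    ring
  rw [← abs_of_pos (pow_pos hδ (4 * n + 8)), ← h3]
  congr 1
  exact det_lower_triangular _ A B ((2 : ℝ) • ql) fun x => rfl

/-! ### The conformal action on the sphere and its Jacobian -/

/-- The extension to the unit ball of the action of a translation followed by a dilation. -/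
def ballMap (δ : ℝ) (v : QHeis n) (x : QSpace n) : QSpace n :=
  cay (affineMap δ v (cayInv x))

/-- The action on the sphere of a left translation followed by a dilation. -/
def sphereMap (δ : ℝ) (hδ : 0 < δ) (v : QHeis n) : Equiv.Perm (QSphere n) :=
  (cayley.symm.trans (transDil δ hδ v).optionCongr).trans cayley

/-- The linear conformal factor of `sphereMap δ hδ v`. -/
def confFactor (δ : ℝ) (v : QHeis n) (ζ : QSphere n) : ℝ :=
  2 * δ / (‖1 + ζ.1.snd‖ * ‖1 + (affineMap δ v (cayInv ζ.1)).snd‖)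

theorem sphereMap_mem_AutS (δ : ℝ) (hδ : 0 < δ) (v : QHeis n) : sphereMap δ hδ v ∈ AutS n := by
  refine ⟨(transDil δ hδ v).optionCongr, ?_, rfl⟩
  have h : (transDil δ hδ v).optionCongr =
      (QHeis.dilation δ hδ).optionCongr * (Equiv.mulLeft v).optionCongr := by
    ext1 x
    cases x <;> rfl
  rw [h]
  refine mul_mem (Subgroup.subset_closure ?_) (Subgroup.subset_closure ?_)
  · exact Or.inl (Or.inl (Or.inr ⟨δ, hδ, rfl⟩))
  · exact Or.inl (Or.inl (Or.inl ⟨v, rfl⟩))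

theorem sphereMap_southPole (δ : ℝ) (hδ : 0 < δ) (v : QHeis n) :
    sphereMap δ hδ v southPole = southPole := by
  have h : (cayley (n := n)).symm southPole = none := by
    rw [Equiv.symm_apply_eq]; rfl
  rw [sphereMap, Equiv.trans_apply, Equiv.trans_apply, h]
  rfl

theorem snd_ne_of_ne_southPole {ζ : QSphere n} (h : ζ ≠ southPole) : ζ.1.snd ≠ -1 :=
  fun h' => h (eq_southPole h')

theorem one_add_snd_ne_zero {ζ : QSphere n} (h : ζ ≠ southPole) : 1 + ζ.1.snd ≠ 0 :=
  one_add_ne_zero_of_ne (snd_ne_of_ne_southPole h)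

theorem sphereMap_apply (δ : ℝ) (hδ : 0 < δ) (v : QHeis n) {ζ : QSphere n} (h : ζ ≠ southPole) :
    sphereMap δ hδ v ζ = cayleyPt (transDil δ hδ v (cayleyInvPt ζ)) := by
  have h' : (cayley (n := n)).symm ζ = some (cayleyInvPt ζ) := if_neg (snd_ne_of_ne_southPole h)
  rw [sphereMap, Equiv.trans_apply, Equiv.trans_apply, h']
  rfl

theorem affineMap_cayInv (δ : ℝ) (hδ : 0 < δ) (v : QHeis n) {ζ : QSphere n} (h : ζ ≠ southPole) :
    affineMap δ v (cayInv ζ.1) = siegelPt (transDil δ hδ v (cayleyInvPt ζ)) := by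
  rw [siegelPt_transDil, cayInv_eq_siegelPt ζ (snd_ne_of_ne_southPole h)]

theorem one_add_affineMap_ne_zero {δ : ℝ} (hδ : 0 < δ) (v : QHeis n) {ζ : QSphere n}
    (h : ζ ≠ southPole) : 1 + (affineMap δ v (cayInv ζ.1)).snd ≠ 0 := by
  rw [affineMap_cayInv δ hδ v h]
  exact QHeis.one_add_rho_ne_zero _

theorem coe_sphereMap (δ : ℝ) (hδ : 0 < δ) (v : QHeis n) {ζ : QSphere n} (h : ζ ≠ southPole) :
    (sphereMap δ hδ v ζ : QSpace n) = ballMap δ v ζ := by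
  rw [sphereMap_apply δ hδ v h, ballMap, affineMap_cayInv δ hδ v h]
  rfl

theorem confFactor_pos {δ : ℝ} (hδ : 0 < δ) (v : QHeis n) {ζ : QSphere n} (h : ζ ≠ southPole) :
    0 < confFactor δ v ζ := by
  have h1 := norm_pos_iff.2 (one_add_snd_ne_zero h)
  have h2 := norm_pos_iff.2 (one_add_affineMap_ne_zero hδ v h)
  unfold confFactor
  positivity

/-- Both sides are the Siegel kernel up to one-variable factors. The kernel only gains `δ ^ 2`,
which is shared equally between the two points. -/
theorem norm_one_sub_sdot_sphereMap (δ : ℝ) (hδ : 0 < δ) (v : QHeis n) {ζ η : QSphere n}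
    (hζ : ζ ≠ southPole) (hη : η ≠ southPole) :
    ‖1 - sdot (sphereMap δ hδ v ζ).1 (sphereMap δ hδ v η).1‖ =
      confFactor δ v ζ * confFactor δ v η * ‖1 - sdot ζ.1 η.1‖ := by
  have h1 := one_add_snd_ne_zero hζ
  have h2 := one_add_snd_ne_zero hη
  have h3 := one_add_affineMap_ne_zero hδ v hζ
  have h4 := one_add_affineMap_ne_zero hδ v hη
  rw [coe_sphereMap δ hδ v hζ, coe_sphereMap δ hδ v hη, ballMap, ballMap,
    norm_one_sub_sdot_cay _ _ h3 h4, siegelKernel_affineMap, norm_smul]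
  have h := norm_one_sub_sdot_cay _ _ (cayInv_snd_add_ne_zero h1) (cayInv_snd_add_ne_zero h2)
  rw [cay_cayInv ζ.1 h1, cay_cayInv η.1 h2, norm_cayInv_snd_add h1, norm_cayInv_snd_add h2] at h
  rw [h, confFactor, confFactor, Real.norm_of_nonneg (sq_nonneg δ)]
  have := norm_ne_zero_iff.2 h1
  have := norm_ne_zero_iff.2 h2
  field_simp

theorem one_sub_norm_ballMap_sq (δ : ℝ) (v : QHeis n) (x : QSpace n) (h1 : 1 + x.snd ≠ 0)
    (h2 : 1 + (affineMap δ v (cayInv x)).snd ≠ 0) :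
    1 - ‖ballMap δ v x‖ ^ 2 = (2 * δ) ^ 2 *
      ((‖1 + x.snd‖ ^ 2)⁻¹ * (‖1 + (affineMap δ v (cayInv x)).snd‖ ^ 2)⁻¹) * (1 - ‖x‖ ^ 2) := by
  rw [ballMap, one_sub_norm_cay_sq _ h2, height_affineMap, height_cayInv _ h1]
  have := norm_ne_zero_iff.2 h1
  have := norm_ne_zero_iff.2 h2
  field_simp
  ring

/-- Differentiating the identity at a unit vector kills the term with the derivative of `c`, because
`1 - ‖x‖²` vanishes there. -/
theorem inner_fderiv_of_one_sub_norm_sq {E : Type*} [NormedAddCommGroup E] [InnerProductSpace ℝ E]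
    {G : E → E} {A : E →L[ℝ] E} {x : E} {c : E → ℝ} (hx : ‖x‖ = 1) (hA : HasFDerivAt G A x)
    (hc : DifferentiableAt ℝ c x) (h : ∀ᶠ y in nhds x, 1 - ‖G y‖ ^ 2 = c y * (1 - ‖y‖ ^ 2))
    (w : E) : inner ℝ (G x) (A w) = c x * inner ℝ x w := by
  have hl := (hA.norm_sq).const_sub 1
  have hr := hc.hasFDerivAt.mul (((hasFDerivAt_id x).norm_sq).const_sub 1)
  have hu := (hr.congr_of_eventuallyEq h).unique hl
  have hw := congrArg (fun T => T w) hu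
  simp [hx] at hw
  linarith

/-- The derivative of the homogeneous extension of a map that preserves the unit sphere. -/
theorem exists_hasFDerivAt_homogeneous {E : Type*} [NormedAddCommGroup E] [InnerProductSpace ℝ E]
    [FiniteDimensional ℝ E] {G : E → E} {A : E →L[ℝ] E} {x : E} {c : ℝ} (hn : ‖x‖ = 1)
    (hG : ‖G x‖ = 1) (hA : HasFDerivAt G A x) (hdet : A.det ≠ 0)
    (h : ∀ w, inner ℝ (G x) (A w) = c * inner ℝ x w) :
    ∃ B : E →L[ℝ] E, HasFDerivAt (fun x => ‖x‖ • G (‖x‖⁻¹ • x)) B x ∧ B.det * c = A.det := by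
  -- The derivative of the extension equals that of `G` on tangent vectors and sends `x` to `G x`:
  -- it is the rank one modification of `A` treated in `det_add_rank_one`.
  refine ⟨_, ?_, det_add_rank_one A hdet x (G x) c hn hG h⟩
  have h1 : HasFDerivAt (fun x : E => ‖x‖) (innerSL ℝ x) x := by
    have h := ((hasFDerivAt_id x).norm_sq).sqrt (by simp [hn])
    simp only [id, Real.sqrt_sq (norm_nonneg _), hn] at h
    convert h using 1
    ext w
    simp only [smul_apply, ContinuousLinearMap.comp_apply,
      ContinuousLinearMap.id_apply, innerSL_apply_apply]
    simp
  have h2 : HasFDerivAt (fun x : E => ‖x‖⁻¹) (-innerSL ℝ x) x := by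
    have h := (hasDerivAt_inv (by rw [hn]; exact one_ne_zero : ‖x‖ ≠ 0)).comp_hasFDerivAt x h1
    exact h.congr_fderiv (by rw [hn]; simp)
  have h3 : HasFDerivAt (fun x : E => ‖x‖⁻¹ • x) _ x := h2.fun_smul (hasFDerivAt_id x)
  have hpt : ‖x‖⁻¹ • x = x := by rw [hn, inv_one, one_smul]
  have h4 : HasFDerivAt (fun x : E => ‖x‖ • G (‖x‖⁻¹ • x)) _ x :=
    h1.fun_smul (HasFDerivAt.comp (g := G) x (by rw [hpt]; exact hA) h3)
  refine h4.congr_fderiv ?_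
  ext1 w
  simp [hn]
  module

theorem homExt_eventuallyEq (τ : QSphere n → QSphere n) {G : QSpace n → QSpace n} {ζ : QSphere n}
    (hτ : ∀ᶠ η in nhds ζ, (τ η : QSpace n) = G η) :
    homExt τ =ᶠ[nhds ζ.1] fun x => ‖x‖ • G (‖x‖⁻¹ • x) := by
  have hn : ‖ζ.1‖ = 1 := norm_eq_of_mem_sphere ζ
  have hζ0 : ζ.1 ≠ 0 := norm_ne_zero_iff.1 (by rw [hn]; exact one_ne_zero)
  have hpt : ‖ζ.1‖⁻¹ • ζ.1 = ζ.1 := by rw [hn, inv_one, one_smul]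
  have hτ' : ∀ᶠ x in nhds ζ.1, ∀ hx : x ∈ Metric.sphere (0 : QSpace n) 1,
      (τ ⟨x, hx⟩ : QSpace n) = G x := by
    rw [nhds_subtype_eq_comap, Filter.eventually_comap] at hτ
    filter_upwards [hτ] with x hx hx'
    exact hx ⟨x, hx'⟩ rfl
  have hcont : ContinuousAt (fun x : QSpace n => ‖x‖⁻¹ • x) ζ.1 :=
    (continuousAt_id.norm.inv₀ (norm_ne_zero_iff.2 hζ0)).smul continuousAt_id
  rw [ContinuousAt, hpt] at hcont
  filter_upwards [hcont.eventually hτ', eventually_ne_nhds hζ0] with x hx hx0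
  rw [homExt, dif_neg hx0, hx]

theorem exists_hasFDerivAt_ballMap {δ : ℝ} (hδ : 0 < δ) (v : QHeis n) {ζ : QSphere n}
    (hζ : ζ ≠ southPole) :
    ∃ A : QSpace n →L[ℝ] QSpace n, HasFDerivAt (ballMap δ v) A ζ ∧
      |A.det| = confFactor δ v ζ ^ (4 * n + 8) ∧
      ∀ w, inner ℝ (ballMap δ v ζ.1) (A w) = confFactor δ v ζ ^ 2 * inner ℝ ζ.1 w := by
  have h1 := one_add_snd_ne_zero hζ
  have h2 := one_add_affineMap_ne_zero hδ v hζ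
  obtain ⟨A₁, hA₁, hd₁⟩ := exists_hasFDerivAt_fracMap 1 one_pos ζ.1 h1
  rw [← cayInv_eq_fracMap] at hA₁
  obtain ⟨A₂, hA₂, hd₂⟩ := exists_hasFDerivAt_affineMap δ hδ v (cayInv ζ.1)
  obtain ⟨A₃, hA₃, hd₃⟩ := exists_hasFDerivAt_fracMap 2 two_pos (affineMap δ v (cayInv ζ.1)) h2
  rw [← cay_eq_fracMap] at hA₃
  have hA₂₁ : HasFDerivAt (fun x => affineMap δ v (cayInv x)) (A₂ ∘L A₁) ζ.1 := hA₂.comp _ hA₁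
  have hA : HasFDerivAt (ballMap δ v) (A₃ ∘L (A₂ ∘L A₁)) ζ.1 :=
    HasFDerivAt.comp (g := cay) ζ.1 hA₃ hA₂₁
  refine ⟨_, hA, ?_, ?_⟩
  -- The `4 n` horizontal directions contribute one power of the conformal factor each and the
  -- remaining four contribute two each, whence `4 n + 8`.
  · have hdet : (A₃ ∘L (A₂ ∘L A₁)).det = A₃.det * (A₂.det * A₁.det) := by
      simp only [ContinuousLinearMap.det, ContinuousLinearMap.toLinearMap_comp, LinearMap.det_comp]
    have := norm_ne_zero_iff.2 h1
    have := norm_ne_zero_iff.2 h2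
    rw [hdet, abs_mul, abs_mul, hd₁, hd₂, hd₃, confFactor]
    simp only [mul_pow, div_pow, inv_pow, one_pow]
    field_simp
    ring
  · have hs : HasFDerivAt (fun x => 1 + (affineMap δ v (cayInv x)).snd) _ ζ.1 :=
      ((hasFDerivAt_snd _).comp ζ.1 hA₂₁).const_add 1
    have hc : DifferentiableAt ℝ (fun x : QSpace n => (2 * δ) ^ 2 *
        ((‖1 + x.snd‖ ^ 2)⁻¹ * (‖1 + (affineMap δ v (cayInv x)).snd‖ ^ 2)⁻¹)) ζ.1 := by
      refine DifferentiableAt.const_mul (DifferentiableAt.mul ?_ ?_) _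
      · exact (((hasFDerivAt_snd ζ.1).const_add 1).norm_sq.differentiableAt).inv
          (pow_ne_zero 2 (norm_ne_zero_iff.2 h1))
      · exact (hs.norm_sq.differentiableAt).inv (pow_ne_zero 2 (norm_ne_zero_iff.2 h2))
    have hev : ∀ᶠ x in nhds ζ.1, 1 - ‖ballMap δ v x‖ ^ 2 = (2 * δ) ^ 2 *
        ((‖1 + x.snd‖ ^ 2)⁻¹ * (‖1 + (affineMap δ v (cayInv x)).snd‖ ^ 2)⁻¹) *
        (1 - ‖x‖ ^ 2) := by
      have e1 := ((hasFDerivAt_snd ζ.1).const_add 1).continuousAt.eventually_ne h1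
      have e2 := hs.continuousAt.eventually_ne h2
      filter_upwards [e1, e2] with x hx1 hx2
      exact one_sub_norm_ballMap_sq δ v x hx1 hx2
    intro w
    rw [inner_fderiv_of_one_sub_norm_sq (norm_eq_of_mem_sphere ζ) hA hc hev, confFactor, div_pow,
      mul_pow _ _ 2, mul_pow _ _ 2, div_eq_mul_inv, mul_inv]

/-- The ball map scales the normal direction by `confFactor ^ 2`, whereas the homogeneous extension
does not scale it. Dividing this out lowers the exponent from `Q + 2` to `Q = 4 n + 6`. -/
theorem exists_hasFDerivAt_homExt_sphereMap {δ : ℝ} (hδ : 0 < δ) (v : QHeis n) {ζ : QSphere n}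
    (hζ : ζ ≠ southPole) :
    ∃ A : QSpace n →L[ℝ] QSpace n, HasFDerivAt (homExt (sphereMap δ hδ v)) A ζ ∧
      |A.det| = confFactor δ v ζ ^ (4 * n + 6) := by
  obtain ⟨A, hA, hd, hi⟩ := exists_hasFDerivAt_ballMap hδ v hζ
  have hpos := confFactor_pos hδ v hζ
  have hev : ∀ᶠ η in nhds ζ, (sphereMap δ hδ v η : QSpace n) = ballMap δ v η := by
    filter_upwards [eventually_ne_nhds hζ] with η hη
    exact coe_sphereMap δ hδ v hη
  have hdet : A.det ≠ 0 := by
    rw [← abs_ne_zero, hd]; positivity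
  have hn : ‖ballMap δ v ζ.1‖ = 1 := by
    rw [← coe_sphereMap δ hδ v hζ]; exact norm_eq_of_mem_sphere _
  obtain ⟨B, hB, hBd⟩ := exists_hasFDerivAt_homogeneous (norm_eq_of_mem_sphere ζ) hn hA hdet hi
  refine ⟨B, hB.congr_of_eventuallyEq (homExt_eventuallyEq _ hev), ?_⟩
  have h' := congrArg abs hBd
  rw [abs_mul, hd, abs_of_pos (pow_pos hpos 2)] at h'
  refine mul_right_cancel₀ (pow_ne_zero 2 hpos.ne') (h'.trans ?_)
  ring

theorem jac_sphereMap {δ : ℝ} (hδ : 0 < δ) (v : QHeis n) {ζ : QSphere n} (hζ : ζ ≠ southPole) :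
    jac (sphereMap δ hδ v) ζ = confFactor δ v ζ ^ (4 * n + 6) := by
  obtain ⟨A, hA, hd⟩ := exists_hasFDerivAt_homExt_sphereMap hδ v hζ
  rw [jac, hA.fderiv, hd]

theorem sphereMap_symm (δ : ℝ) (hδ : 0 < δ) (v : QHeis n) :
    ∃ v' : QHeis n, (sphereMap δ hδ v).symm = sphereMap δ⁻¹ (inv_pos.2 hδ) v' := by
  obtain ⟨v', hv'⟩ := transDil_symm δ hδ v
  refine ⟨v', ?_⟩
  rw [sphereMap, sphereMap, ← hv']
  ext1 ζ
  simp [Equiv.optionCongr_symm]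

/-! ### Change of variables on the sphere -/

theorem norm_smul_inv_mem_sphere {x : QSpace n} (hx : x ≠ 0) :
    ‖x‖⁻¹ • x ∈ Metric.sphere (0 : QSpace n) 1 := by
  rw [mem_sphere_zero_iff_norm, norm_smul, norm_inv, norm_norm,
    inv_mul_cancel₀ (norm_ne_zero_iff.2 hx)]

open Classical in
/-- The radial projection `x ↦ x / |x|` onto the sphere. -/
def radialProj (x : QSpace n) : QSphere n :=
  if hx : x = 0 then southPole else ⟨‖x‖⁻¹ • x, norm_smul_inv_mem_sphere hx⟩

theorem coe_radialProj {x : QSpace n} (hx : x ≠ 0) : (radialProj x : QSpace n) = ‖x‖⁻¹ • x := by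
  rw [radialProj, dif_neg hx]

theorem norm_smul_radialProj (x : QSpace n) : ‖x‖ • (radialProj x : QSpace n) = x := by
  by_cases hx : x = 0
  · simp [hx]
  · rw [coe_radialProj hx, smul_inv_smul₀ (norm_ne_zero_iff.2 hx)]

theorem radialProj_smul {r : ℝ} (hr : 0 < r) (ζ : QSphere n) : radialProj (r • ζ.1) = ζ := by
  have hn : ‖ζ.1‖ = 1 := norm_eq_of_mem_sphere ζ
  have h0 : r • ζ.1 ≠ 0 := smul_ne_zero hr.ne' (norm_ne_zero_iff.1 (by rw [hn]; exact one_ne_zero))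
  apply Subtype.ext
  rw [coe_radialProj h0, norm_smul, hn, mul_one, Real.norm_of_nonneg hr.le,
    inv_smul_smul₀ hr.ne']

theorem homExt_eq (τ : QSphere n → QSphere n) (x : QSpace n) :
    homExt τ x = ‖x‖ • (τ (radialProj x) : QSpace n) := by
  by_cases hx : x = 0
  · simp [homExt, hx]
  · rw [homExt, dif_neg hx, radialProj, dif_neg hx]

theorem norm_homExt (τ : QSphere n → QSphere n) (x : QSpace n) : ‖homExt τ x‖ = ‖x‖ := by
  rw [homExt_eq, norm_smul, norm_norm, norm_eq_of_mem_sphere, mul_one]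

theorem radialProj_homExt (τ : QSphere n → QSphere n) {x : QSpace n} (hx : x ≠ 0) :
    radialProj (homExt τ x) = τ (radialProj x) := by
  rw [homExt_eq, radialProj_smul (norm_pos_iff.2 hx)]

theorem homExt_symm_homExt (τ : Equiv.Perm (QSphere n)) (x : QSpace n) :
    homExt τ.symm (homExt τ x) = x := by
  by_cases hx : x = 0
  · simp [homExt, hx]
  · rw [homExt_eq τ.symm, norm_homExt, radialProj_homExt τ hx, Equiv.symm_apply_apply,
      norm_smul_radialProj]

theorem homExt_smul (τ : QSphere n → QSphere n) {r : ℝ} (hr : 0 < r) (x : QSpace n) :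
    homExt τ (r • x) = r • homExt τ x := by
  have h : radialProj (r • x) = radialProj x := by
    by_cases hx : x = 0
    · simp [hx]
    · nth_rw 1 [← norm_smul_radialProj x]
      rw [smul_smul, radialProj_smul (mul_pos hr (norm_pos_iff.2 hx))]
  rw [homExt_eq, homExt_eq, h, norm_smul, Real.norm_of_nonneg hr.le, mul_smul]

theorem hasFDerivAt_homExt_smul {τ : QSphere n → QSphere n} {r : ℝ} (hr : 0 < r) {x : QSpace n}
    {B : QSpace n →L[ℝ] QSpace n} (hB : HasFDerivAt (homExt τ) B x) :
    HasFDerivAt (homExt τ) B (r • x) := by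
  have h1 : homExt τ = fun y => r • homExt τ (r⁻¹ • y) := by
    funext y
    rw [← homExt_smul τ hr, smul_inv_smul₀ hr.ne']
  rw [h1]
  have h2 : HasFDerivAt (fun y : QSpace n => r⁻¹ • y) (r⁻¹ • ContinuousLinearMap.id ℝ (QSpace n))
      (r • x) := (hasFDerivAt_id _).const_smul r⁻¹
  have h3 : HasFDerivAt (fun y => homExt τ (r⁻¹ • y)) _ (r • x) :=
    HasFDerivAt.comp (g := homExt τ) (r • x) (by rw [inv_smul_smul₀ hr.ne']; exact hB) h2
  refine (h3.const_smul r).congr_fderiv ?_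
  ext1 w
  simp [smul_smul, hr.ne']

theorem measurable_radialProj : Measurable (radialProj : QSpace n → QSphere n) := by
  refine measurable_of_continuousOn_compl_singleton 0 ?_
  refine Topology.IsEmbedding.subtypeVal.continuousOn_iff.2 ?_
  refine ContinuousOn.congr (f := fun x : QSpace n => ‖x‖⁻¹ • x) ?_ fun x hx => coe_radialProj hx
  exact (continuousOn_id.norm.inv₀ fun x hx => norm_ne_zero_iff.2 hx).smul continuousOn_id

theorem volume_span_singleton (x : QSpace n) :
    volume ((Submodule.span ℝ {x} : Submodule ℝ (QSpace n)) : Set (QSpace n)) = 0 := by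
  refine Measure.addHaar_submodule _ _ fun h => ?_
  have h1 := finrank_span_le_card (R := ℝ) ({x} : Set (QSpace n))
  rw [h, finrank_top, finrank_qspace, Set.toFinset_singleton, Finset.card_singleton] at h1
  omega

theorem volume_radialProj_preimage (ζ : QSphere n) : volume (radialProj ⁻¹' {ζ}) = 0 := by
  refine measure_mono_null (fun x hx => ?_) (volume_span_singleton ζ.1)
  refine Submodule.mem_span_singleton.2 ⟨‖x‖, ?_⟩
  have hx' : radialProj x = ζ := hx
  rw [← hx', norm_smul_radialProj]

/-- Surface measure is defined by volumes of cones in the unit ball. In this form, sphere integrals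
become ball integrals of radially constant functions. -/
theorem sigma_eq_map : sigma n = (Module.finrank ℝ (QSpace n) : ENNReal) •
    Measure.map radialProj (volume.restrict (Metric.ball 0 1)) := by
  ext s hs
  rw [sigma, Measure.toSphere_apply' _ hs, Measure.smul_apply, smul_eq_mul,
    Measure.map_apply measurable_radialProj hs,
    Measure.restrict_apply (measurable_radialProj hs)]
  congr 1
  have h0 : volume ({0} : Set (QSpace n)) = 0 := by
    refine measure_mono_null ?_ (volume_span_singleton (0 : QSpace n))
    simp
  rw [← measure_sdiff_null h0 (s := radialProj ⁻¹' s ∩ Metric.ball 0 1)]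
  congr 1
  ext x
  constructor
  · rintro ⟨r, hr, y, ⟨ζ, hζ, rfl⟩, rfl⟩
    change r • ζ.1 ∈ _
    have hn : ‖r • ζ.1‖ = r := by
      rw [norm_smul, norm_eq_of_mem_sphere, mul_one, Real.norm_of_nonneg hr.1.le]
    refine ⟨⟨?_, ?_⟩, ?_⟩
    · rw [Set.mem_preimage, radialProj_smul hr.1]; exact hζ
    · rw [mem_ball_zero_iff, hn]; exact hr.2
    · intro h
      rw [Set.mem_singleton_iff.1 h, norm_zero] at hn
      exact hr.1.ne hn
  · rintro ⟨⟨h1, h2⟩, h3⟩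
    exact ⟨‖x‖, ⟨norm_pos_iff.2 h3, mem_ball_zero_iff.1 h2⟩, _, ⟨_, h1, rfl⟩,
      norm_smul_radialProj x⟩

theorem lintegral_sigma {φ : QSphere n → ENNReal} (hφ : Measurable φ) :
    ∫⁻ ζ, φ ζ ∂(sigma n) =
      Module.finrank ℝ (QSpace n) * ∫⁻ x in Metric.ball 0 1, φ (radialProj x) := by
  rw [sigma_eq_map, lintegral_smul_measure, smul_eq_mul, lintegral_map hφ measurable_radialProj]

theorem sigma_singleton (ζ : QSphere n) : sigma n {ζ} = 0 := by
  rw [sigma_eq_map, Measure.smul_apply, Measure.map_apply measurable_radialProj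
    (measurableSet_singleton ζ), measure_mono_null Set.inter_subset_left
    (volume_radialProj_preimage ζ) |> fun h =>
      (Measure.restrict_apply (measurable_radialProj (measurableSet_singleton ζ))).trans h,
    smul_zero]

instance : IsFiniteMeasure (sigma n) :=
  inferInstanceAs (IsFiniteMeasure (volume : Measure (QSpace n)).toSphere)

theorem measurable_jac (τ : QSphere n → QSphere n) : Measurable (jac τ) :=
  ((ContinuousLinearMap.continuous_det.measurable.comp
    ((measurable_fderiv ℝ (homExt τ)).comp measurable_subtype_coe))).abs

theorem jac_nonneg (τ : QSphere n → QSphere n) (ζ : QSphere n) : 0 ≤ jac τ ζ := abs_nonneg _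

/-- The homogeneous extension preserves norms and has a derivative constant along rays, so the
change of variables on the sphere is the Euclidean one on the unit ball. -/
theorem lintegral_jac_mul_comp (τ : Equiv.Perm (QSphere n)) (o : QSphere n) (ho : τ o = o)
    (hτ : Measurable τ) (hd : ∀ ζ ≠ o, DifferentiableAt ℝ (homExt τ) (ζ : QSpace n))
    {φ : QSphere n → ENNReal} (hφ : Measurable φ) :
    ∫⁻ ζ, ENNReal.ofReal (jac τ ζ) * φ (τ ζ) ∂(sigma n) = ∫⁻ ζ, φ ζ ∂(sigma n) := by
  rw [lintegral_sigma hφ,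
    lintegral_sigma (φ := fun ζ => ENNReal.ofReal (jac τ ζ) * φ (τ ζ))
      ((measurable_jac τ).ennreal_ofReal.mul (hφ.comp hτ))]
  congr 1
  -- The origin and the ray through the fixed point `o`, where differentiability is not assumed, are
  -- removed. They are null, and the extension permutes the remaining points of the ball.
  set s : Set (QSpace n) := Metric.ball 0 1 ∩ ({0}ᶜ ∩ (radialProj ⁻¹' {o})ᶜ) with hs
  have hsm : MeasurableSet s := Metric.isOpen_ball.measurableSet.inter
    ((measurableSet_singleton _).compl.inter (measurable_radialProj (measurableSet_singleton _)).compl)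
  have hae : Metric.ball (0 : QSpace n) 1 =ᵐ[volume] s := by
    have h1 : ∀ᵐ x : QSpace n, x ∈ ({0}ᶜ ∩ (radialProj ⁻¹' {o})ᶜ : Set (QSpace n)) := by
      have h2 : ∀ᵐ x : QSpace n, x ∉ ({0} : Set (QSpace n)) := by
        refine measure_eq_zero_iff_ae_notMem.1
          (measure_mono_null ?_ (volume_span_singleton (0 : QSpace n)))
        simp
      filter_upwards [h2, measure_eq_zero_iff_ae_notMem.1 (volume_radialProj_preimage o)]
        with x hx hx'
      exact ⟨hx, hx'⟩
    filter_upwards [h1] with x hx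
    exact propext ⟨fun h => ⟨h, hx⟩, fun h => h.1⟩
  have hmaps : ∀ (ρ : Equiv.Perm (QSphere n)), ρ o = o → ∀ x ∈ s, homExt ρ x ∈ s := by
    rintro ρ hρ x ⟨h1, h2, h3⟩
    have hx : x ≠ 0 := h2
    refine ⟨?_, ?_, ?_⟩
    · rw [mem_ball_zero_iff, norm_homExt]; exact mem_ball_zero_iff.1 h1
    · exact norm_ne_zero_iff.1 (by rw [norm_homExt]; exact norm_ne_zero_iff.2 hx)
    · intro h
      apply h3
      have h' : radialProj (homExt ρ x) = o := h
      rw [radialProj_homExt ρ hx] at h'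
      exact ρ.injective (h'.trans hρ.symm)
  have himage : homExt τ '' s = s := by
    apply Set.Subset.antisymm
    · rintro _ ⟨x, hx, rfl⟩
      exact hmaps τ ho x hx
    · intro x hx
      refine ⟨homExt τ.symm x, hmaps τ.symm ?_ x hx, ?_⟩
      · rw [Equiv.symm_apply_eq, ho]
      · exact homExt_symm_homExt τ.symm x
  have hder : ∀ x ∈ s, HasFDerivAt (homExt τ) (fderiv ℝ (homExt τ) (radialProj x)) x := by
    rintro x ⟨-, h2, h3⟩
    have h := hasFDerivAt_homExt_smul (norm_pos_iff.2 h2) (hd _ h3).hasFDerivAt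
    rwa [norm_smul_radialProj] at h
  rw [setLIntegral_congr hae, setLIntegral_congr hae]
  nth_rw 2 [← himage]
  rw [lintegral_image_eq_lintegral_abs_det_fderiv_mul volume hsm
    (fun x hx => (hder x hx).hasFDerivWithinAt)
    (fun x _ y _ hxy => by rw [← homExt_symm_homExt τ x, hxy, homExt_symm_homExt])]
  refine setLIntegral_congr_fun hsm fun x hx => ?_
  rw [radialProj_homExt τ hx.2.1, jac]

theorem measurable_sphereMap (δ : ℝ) (hδ : 0 < δ) (v : QHeis n) :
    Measurable (sphereMap δ hδ v) := by
  refine measurable_of_continuousOn_compl_singleton southPole ?_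
  refine Topology.IsEmbedding.subtypeVal.continuousOn_iff.2 ?_
  have hcoe : ∀ ζ ∈ ({southPole}ᶜ : Set (QSphere n)),
      (Subtype.val ∘ sphereMap δ hδ v) ζ = ballMap δ v ζ.1 := by
    intro ζ hζ
    rw [Function.comp_apply]
    exact coe_sphereMap δ hδ v hζ
  refine ContinuousOn.congr (f := fun ζ : QSphere n => ballMap δ v ζ.1) ?_ hcoe
  intro ζ hζ
  obtain ⟨A, hA, -⟩ := exists_hasFDerivAt_ballMap hδ v hζ
  exact (hA.continuousAt.comp continuousAt_subtype_val).continuousWithinAt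

theorem measurePreserving_sphereMap (δ : ℝ) (hδ : 0 < δ) (v : QHeis n) :
    MeasurePreserving (sphereMap δ hδ v)
      ((sigma n).withDensity fun ζ => ENNReal.ofReal (jac (sphereMap δ hδ v) ζ)) (sigma n) := by
  have hm := measurable_sphereMap δ hδ v
  refine ⟨hm, ?_⟩
  ext s hs
  rw [Measure.map_apply hm hs, withDensity_apply _ (hm hs), ← lintegral_indicator (hm hs),
    ← lintegral_indicator_one hs, ← lintegral_jac_mul_comp (sphereMap δ hδ v) southPole
      (sphereMap_southPole δ hδ v) hm (fun ζ hζ => ?_) (measurable_one.indicator hs)]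
  · refine lintegral_congr fun ζ => ?_
    by_cases h : sphereMap δ hδ v ζ ∈ s <;> simp [h]
  · obtain ⟨A, hA, -⟩ := exists_hasFDerivAt_homExt_sphereMap hδ v hζ
    exact hA.differentiableAt

theorem measurableEmbedding_sphereMap (δ : ℝ) (hδ : 0 < δ) (v : QHeis n) :
    MeasurableEmbedding (sphereMap δ hδ v) :=
  (measurable_sphereMap δ hδ v).measurableEmbedding (sphereMap δ hδ v).injective

/-! ### Conformal transforms of extremizers -/

theorem ae_ne_southPole : ∀ᵐ ζ ∂(sigma n), ζ ≠ southPole :=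
  measure_eq_zero_iff_ae_notMem.1 (sigma_singleton southPole)

theorem hdim_pos (n : ℕ) : 0 < hdim n := by unfold hdim; positivity

theorem pExp_pos {lam : ℝ} (hlamQ : lam < hdim n) : 0 < pExp n lam := by
  have := hdim_pos n
  exact div_pos (by linarith) (by linarith)

theorem jac_sphereMap_pos {δ : ℝ} (hδ : 0 < δ) (v : QHeis n) {ζ : QSphere n}
    (hζ : ζ ≠ southPole) : 0 < jac (sphereMap δ hδ v) ζ := by
  rw [jac_sphereMap hδ v hζ]
  exact pow_pos (confFactor_pos hδ v hζ) _

theorem quasiMeasurePreserving_sphereMap (δ : ℝ) (hδ : 0 < δ) (v : QHeis n) :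
    Measure.QuasiMeasurePreserving (sphereMap δ hδ v) (sigma n) (sigma n) := by
  refine (measurePreserving_sphereMap δ hδ v).quasiMeasurePreserving.mono_left ?_
  refine withDensity_absolutelyContinuous' (measurable_jac _).ennreal_ofReal.aemeasurable ?_
  filter_upwards [ae_ne_southPole] with ζ hζ
  exact (ENNReal.ofReal_pos.2 (jac_sphereMap_pos hδ v hζ)).ne'

theorem ae_conformalTransform_pos (lam : ℝ) (δ : ℝ) (hδ : 0 < δ) (v : QHeis n)
    {h : QSphere n → ℝ} (hh : ∀ᵐ ζ ∂(sigma n), 0 < h ζ) :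
    ∀ᵐ ζ ∂(sigma n), 0 < conformalTransform lam (sphereMap δ hδ v).symm h ζ := by
  filter_upwards [ae_ne_southPole, (quasiMeasurePreserving_sphereMap δ hδ v).ae hh] with ζ h1 h2
  exact mul_pos (Real.rpow_pos_of_pos (jac_sphereMap_pos hδ v h1) _) h2

theorem aestronglyMeasurable_conformalTransform (lam : ℝ) (δ : ℝ) (hδ : 0 < δ) (v : QHeis n)
    {h : QSphere n → ℝ} (hh : AEStronglyMeasurable (fun ζ => (h ζ : ℂ)) (sigma n)) :
    AEStronglyMeasurable (fun ζ => (conformalTransform lam (sphereMap δ hδ v).symm h ζ : ℂ))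
      (sigma n) := by
  have h1 : AEStronglyMeasurable
      (fun ζ => ((jac (sphereMap δ hδ v) ζ ^ (1 / pExp n lam) : ℝ) : ℂ)) (sigma n) :=
    (Complex.measurable_ofReal.comp
      ((measurable_jac _).pow_const (1 / pExp n lam))).aestronglyMeasurable
  have h2 := hh.comp_quasiMeasurePreserving (quasiMeasurePreserving_sphereMap δ hδ v)
  refine (h1.mul h2).congr (Filter.Eventually.of_forall fun ζ => ?_)
  simp [conformalTransform]

theorem eLpNorm_conformalTransform {lam : ℝ} (hlamQ : lam < hdim n) (δ : ℝ) (hδ : 0 < δ)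
    (v : QHeis n) (h : QSphere n → ℝ) :
    eLpNorm (fun ζ => (conformalTransform lam (sphereMap δ hδ v).symm h ζ : ℂ))
      (ENNReal.ofReal (pExp n lam)) (sigma n) =
    eLpNorm (fun ζ => (h ζ : ℂ)) (ENNReal.ofReal (pExp n lam)) (sigma n) := by
  have hp := pExp_pos hlamQ
  have hp0 : ENNReal.ofReal (pExp n lam) ≠ 0 := (ENNReal.ofReal_pos.2 hp).ne'
  rw [eLpNorm_eq_lintegral_rpow_enorm_toReal hp0 ENNReal.ofReal_ne_top,
    eLpNorm_eq_lintegral_rpow_enorm_toReal hp0 ENNReal.ofReal_ne_top, ENNReal.toReal_ofReal hp.le]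
  congr 1
  rw [← (measurePreserving_sphereMap δ hδ v).lintegral_comp_emb
    (measurableEmbedding_sphereMap δ hδ v) (fun ζ => ‖(h ζ : ℂ)‖ₑ ^ pExp n lam),
    lintegral_withDensity_eq_lintegral_mul_non_measurable _ (measurable_jac _).ennreal_ofReal
      (Filter.Eventually.of_forall fun _ => ENNReal.ofReal_lt_top)]
  refine lintegral_congr fun ζ => ?_
  have hj := jac_nonneg (sphereMap δ hδ v) ζ
  have h1 : ‖((conformalTransform lam (sphereMap δ hδ v).symm h ζ : ℝ) : ℂ)‖ₑ =
      ENNReal.ofReal (jac (sphereMap δ hδ v) ζ ^ (1 / pExp n lam)) *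
        ‖((h (sphereMap δ hδ v ζ) : ℝ) : ℂ)‖ₑ := by
    rw [conformalTransform, Equiv.symm_symm, Complex.ofReal_mul, enorm_mul, ← ofReal_norm,
      Complex.norm_real, Real.norm_of_nonneg (Real.rpow_nonneg hj _)]
  rw [h1, ENNReal.mul_rpow_of_nonneg _ _ hp.le, ENNReal.ofReal_rpow_of_nonneg
    (Real.rpow_nonneg hj _) hp.le, ← Real.rpow_mul hj, one_div, inv_mul_cancel₀ hp.ne',
    Real.rpow_one]
  rfl

theorem dS_sphereMap (δ : ℝ) (hδ : 0 < δ) (v : QHeis n) {ζ η : QSphere n}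
    (hζ : ζ ≠ southPole) (hη : η ≠ southPole) :
    dS (sphereMap δ hδ v ζ) (sphereMap δ hδ v η) =
      (confFactor δ v ζ) ^ (1 / 2 : ℝ) * (confFactor δ v η) ^ (1 / 2 : ℝ) * dS ζ η := by
  have h1 := (confFactor_pos hδ v hζ).le
  have h2 := (confFactor_pos hδ v hη).le
  rw [dS, dS, norm_one_sub_sdot_sphereMap δ hδ v hζ hη, Real.sqrt_mul (mul_nonneg h1 h2),
    Real.sqrt_mul h1, Real.sqrt_eq_rpow (confFactor δ v ζ), Real.sqrt_eq_rpow (confFactor δ v η)]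
  ring

theorem dS_nonneg (ζ η : QSphere n) : 0 ≤ dS ζ η := by unfold dS; positivity

theorem hlsIntegrand_conformalTransform {lam : ℝ} (δ : ℝ) (hδ : 0 < δ)
    (v : QHeis n) (h : QSphere n → ℝ) {x : QSphere n × QSphere n}
    (h1 : x.1 ≠ southPole) (h2 : x.2 ≠ southPole) :
    hlsIntegrand lam (fun ζ => (conformalTransform lam (sphereMap δ hδ v).symm h ζ : ℂ))
      (fun ζ => (conformalTransform lam (sphereMap δ hδ v).symm h ζ : ℂ)) x =
    (jac (sphereMap δ hδ v) x.1 * jac (sphereMap δ hδ v) x.2) •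
      hlsIntegrand lam (fun ζ => (h ζ : ℂ)) (fun ζ => (h ζ : ℂ))
        (Prod.map (sphereMap δ hδ v) (sphereMap δ hδ v) x) := by
  have hQ := hdim_pos n
  -- With `J = c ^ Q` and `1 / p = 1 - λ / (2 Q)`, this is the exponent identity `Q / p + λ / 2 =
  -- Q`: the Jacobian power and the distortion of the distance combine to exactly one Jacobian.
  have key : ∀ ζ : QSphere n, ζ ≠ southPole →
      jac (sphereMap δ hδ v) ζ ^ (1 / pExp n lam) * (confFactor δ v ζ ^ (1 / 2 : ℝ)) ^ lam =
        jac (sphereMap δ hδ v) ζ := by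
    intro ζ hζ
    have hc := confFactor_pos hδ v hζ
    have hj : jac (sphereMap δ hδ v) ζ = confFactor δ v ζ ^ hdim n := by
      rw [jac_sphereMap hδ v hζ, ← Real.rpow_natCast, hdim]
      norm_num
    rw [hj, ← Real.rpow_mul hc.le, ← Real.rpow_mul hc.le, ← Real.rpow_add hc]
    congr 1
    unfold pExp
    field_simp
    ring
  have hc1 := confFactor_pos hδ v h1
  have hc2 := confFactor_pos hδ v h2
  have hp1 : (confFactor δ v x.1 ^ (1 / 2 : ℝ)) ^ lam ≠ 0 := by positivity
  have hp2 : (confFactor δ v x.2 ^ (1 / 2 : ℝ)) ^ lam ≠ 0 := by positivity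
  rw [← key x.1 h1, ← key x.2 h2]
  simp only [hlsIntegrand, conformalTransform, Prod.map, Equiv.symm_symm, Complex.conj_ofReal]
  rw [dS_sphereMap δ hδ v h1 h2, Real.mul_rpow (by positivity) (dS_nonneg _ _),
    Real.mul_rpow (by positivity) (by positivity), Complex.real_smul]
  simp only [← Complex.ofReal_mul, ← Complex.ofReal_div]
  congr 1
  rw [key x.1 h1, key x.2 h2]
  have e1 := key x.1 h1
  have e2 := key x.2 h2
  generalize jac (sphereMap δ hδ v) x.1 ^ (1 / pExp n lam) = a at *
  generalize jac (sphereMap δ hδ v) x.2 ^ (1 / pExp n lam) = b at *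
  rw [← e1, ← e2]
  field_simp

theorem hlsForm_conformalTransform {lam : ℝ} (δ : ℝ) (hδ : 0 < δ)
    (v : QHeis n) (h : QSphere n → ℝ) :
    hlsForm lam (fun ζ => (conformalTransform lam (sphereMap δ hδ v).symm h ζ : ℂ))
      (fun ζ => (conformalTransform lam (sphereMap δ hδ v).symm h ζ : ℂ)) =
    hlsForm lam (fun ζ => (h ζ : ℂ)) (fun ζ => (h ζ : ℂ)) := by
  have hJ := (measurable_jac (sphereMap δ hδ v)).ennreal_ofReal
  have hmp := (measurePreserving_sphereMap δ hδ v).prod (measurePreserving_sphereMap δ hδ v)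
  have hemb := (measurableEmbedding_sphereMap δ hδ v).prodMap
    (measurableEmbedding_sphereMap δ hδ v)
  rw [hlsForm, hlsForm, ← hmp.integral_comp hemb
      (hlsIntegrand lam (fun ζ => (h ζ : ℂ)) (fun ζ => (h ζ : ℂ))), prod_withDensity hJ hJ,
    integral_withDensity_eq_integral_toReal_smul
      (f := fun z : QSphere n × QSphere n => ENNReal.ofReal (jac (sphereMap δ hδ v) z.1) *
        ENNReal.ofReal (jac (sphereMap δ hδ v) z.2))
      ((hJ.comp measurable_fst).mul (hJ.comp measurable_snd))
      (Filter.Eventually.of_forall fun _ =>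
        ENNReal.mul_lt_top ENNReal.ofReal_lt_top ENNReal.ofReal_lt_top)]
  refine integral_congr_ae ?_
  filter_upwards [Measure.quasiMeasurePreserving_fst.ae ae_ne_southPole,
    Measure.quasiMeasurePreserving_snd.ae ae_ne_southPole] with x h1 h2
  rw [hlsIntegrand_conformalTransform δ hδ v h h1 h2, ENNReal.toReal_mul,
    ENNReal.toReal_ofReal (jac_nonneg _ _), ENNReal.toReal_ofReal (jac_nonneg _ _)]

theorem isPosExtremizer_conformalTransform {lam : ℝ} (hlamQ : lam < hdim n) (δ : ℝ) (hδ : 0 < δ)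
    (v : QHeis n) {h : QSphere n → ℝ} (hh : IsPosExtremizer lam h) :
    IsPosExtremizer lam (conformalTransform lam (sphereMap δ hδ v).symm h) := by
  obtain ⟨hpos, hmem, hne, K, hK, heq⟩ := hh
  have hpos' := ae_conformalTransform_pos lam δ hδ v hpos
  have hnorm := eLpNorm_conformalTransform hlamQ δ hδ v h
  refine ⟨hpos', ⟨aestronglyMeasurable_conformalTransform lam δ hδ v hmem.1, ?_⟩, ?_, K, hK, ?_⟩
  · rw [hnorm]; exact hmem.2
  · intro h0
    apply hne
    filter_upwards [hpos', h0] with ζ h1 h2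
    exact absurd (Complex.ofReal_eq_zero.1 h2) h1.ne'
  · rw [hlsForm_conformalTransform, heq, lpNorm, lpNorm, hnorm]

/-- The `p`-th power of the weight is the full Jacobian, so the change of variables moves the
transformation from the density onto the point `ζ`. -/
theorem integral_conformalTransform {lam : ℝ} (hlamQ : lam < hdim n) (δ : ℝ) (hδ : 0 < δ)
    (v : QHeis n) {h : QSphere n → ℝ} (hh : ∀ᵐ ζ ∂(sigma n), 0 < h ζ) :
    ∫ ζ, (conformalTransform lam (sphereMap δ hδ v).symm h ζ ^ pExp n lam) • (ζ : QSpace n)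
      ∂(sigma n) =
    ∫ ζ, (h ζ ^ pExp n lam) • ((sphereMap δ hδ v).symm ζ : QSpace n) ∂(sigma n) := by
  have hp := pExp_pos hlamQ
  rw [← (measurePreserving_sphereMap δ hδ v).integral_comp (measurableEmbedding_sphereMap δ hδ v)
      (fun ζ => (h ζ ^ pExp n lam) • ((sphereMap δ hδ v).symm ζ : QSpace n)),
    integral_withDensity_eq_integral_toReal_smul (measurable_jac _).ennreal_ofReal
      (Filter.Eventually.of_forall fun _ => ENNReal.ofReal_lt_top)]
  refine integral_congr_ae ?_
  filter_upwards [(quasiMeasurePreserving_sphereMap δ hδ v).ae hh] with ζ hζ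
  have hj := jac_nonneg (sphereMap δ hδ v) ζ
  rw [Equiv.symm_apply_apply, ENNReal.toReal_ofReal hj, smul_smul, conformalTransform,
    Equiv.symm_symm, Real.mul_rpow (Real.rpow_nonneg hj _) hζ.le, ← Real.rpow_mul hj, one_div,
    inv_mul_cancel₀ hp.ne', Real.rpow_one]

/-! ### The conformal barycenter -/

theorem re_qdot (a b : EuclideanSpace ℍ[ℝ] (Fin n)) : (qdot a b).re = inner ℝ a b := by
  rw [qdot, PiLp.inner_apply]
  simp only [Quaternion.inner_def]
  exact map_sum (QuaternionAlgebra.reₗ (-1 : ℝ) 0 (-1)) _ _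

theorem re_sdot (x y : QSpace n) : (sdot x y).re = inner ℝ x y := by
  rw [sdot, Quaternion.re_add, re_qdot, WithLp.prod_inner_apply, Quaternion.inner_def]
  rfl

theorem sdot_smul_left (t : ℝ) (x y : QSpace n) : sdot (t • x) y = t • sdot x y := by
  change qdot (t • x.fst) y.fst + t • x.snd * star y.snd = _
  rw [qdot_real_smul_left, sdot, smul_mul_assoc, smul_add]

theorem continuous_sdot : Continuous fun x : QSpace n × QSpace n => sdot x.1 x.2 := by
  have h1 : Continuous fun x : QSpace n => x.fst :=
    (WithLp.fstL 2 ℝ (EuclideanSpace ℍ[ℝ] (Fin n)) ℍ[ℝ]).continuous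
  have h2 : Continuous fun x : QSpace n => x.snd :=
    (WithLp.sndL 2 ℝ (EuclideanSpace ℍ[ℝ] (Fin n)) ℍ[ℝ]).continuous
  have h3 : ∀ j : Fin n, Continuous fun x : EuclideanSpace ℍ[ℝ] (Fin n) => x j :=
    fun j => (continuous_apply j).comp (PiLp.continuous_ofLp 2 _)
  refine Continuous.add (continuous_finsetSum _ fun j _ => Continuous.mul ?_ ?_)
    (Continuous.mul (h2.comp continuous_fst) (continuous_star.comp (h2.comp continuous_snd)))
  · exact (h3 j).comp (h1.comp continuous_fst)
  · exact continuous_star.comp ((h3 j).comp (h1.comp continuous_snd))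

theorem continuous_sdot_coe (m : QSpace n) : Continuous fun ζ : QSphere n => sdot m ζ.1 :=
  Continuous.comp (g := fun x : QSpace n × QSpace n => sdot x.1 x.2)
    (f := fun ζ : QSphere n => (m, ζ.1)) continuous_sdot (by fun_prop)

/-- The modulus dominates the real part `1 - ⟨z, ζ⟩`, and `|z - ζ|² ≤ 2 - 2 ⟨z, ζ⟩` in the closed
ball. -/
theorem norm_sub_sq_le (z : QSpace n) (hz : ‖z‖ ≤ 1) (ζ : QSphere n) :
    ‖z - ζ‖ ^ 2 / 2 ≤ ‖1 - sdot z ζ‖ := by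
  have h1 : (1 - sdot z ζ.1).re ≤ ‖1 - sdot z ζ.1‖ := by
    have h := real_inner_le_norm (1 - sdot z ζ.1) (1 : ℍ[ℝ])
    rw [Quaternion.inner_def] at h
    simpa using h
  rw [Quaternion.re_sub, Quaternion.re_one, re_sdot] at h1
  have h2 := norm_sub_sq_real z ζ.1
  have h3 : ‖ζ.1‖ = 1 := norm_eq_of_mem_sphere ζ
  rw [h3] at h2
  nlinarith [norm_nonneg z]

theorem one_sub_norm_le (z : QSpace n) (ζ : QSphere n) : 1 - ‖z‖ ≤ ‖1 - sdot z ζ‖ := by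
  have h1 : (1 - sdot z ζ.1).re ≤ ‖1 - sdot z ζ.1‖ := by
    have h := real_inner_le_norm (1 - sdot z ζ.1) (1 : ℍ[ℝ])
    rw [Quaternion.inner_def] at h
    simpa using h
  rw [Quaternion.re_sub, Quaternion.re_one, re_sdot] at h1
  have h2 := real_inner_le_norm z ζ.1
  have h3 : ‖ζ.1‖ = 1 := norm_eq_of_mem_sphere ζ
  rw [h3, mul_one] at h2
  linarith

/-- The inverse Poisson kernel `|1 - z · ζ̄|² / (1 - |z|²)` of the unit ball. -/
def poisson (z : QSpace n) (ζ : QSphere n) : ℝ := ‖1 - sdot z ζ‖ ^ 2 / (1 - ‖z‖ ^ 2)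

theorem one_sub_norm_sq_pos {z : QSpace n} (hz : ‖z‖ < 1) : 0 < 1 - ‖z‖ ^ 2 := by
  nlinarith [norm_nonneg z]

theorem poisson_pos {z : QSpace n} (hz : ‖z‖ < 1) (ζ : QSphere n) : 0 < poisson z ζ := by
  have h1 : 0 < ‖1 - sdot z ζ‖ := lt_of_lt_of_le (by linarith) (one_sub_norm_le z ζ)
  exact div_pos (pow_pos h1 2) (one_sub_norm_sq_pos hz)

theorem continuousOn_log_poisson :
    ContinuousOn (fun x : QSpace n × QSphere n => Real.log (poisson x.1 x.2))
      {x | ‖x.1‖ < 1} := by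
  have h1 : Continuous fun x : QSpace n × QSphere n => ‖1 - sdot x.1 x.2‖ ^ 2 :=
    ((continuous_const.sub (continuous_sdot.comp
      (continuous_fst.prodMk (continuous_subtype_val.comp continuous_snd)))).norm).pow 2
  have h2 : Continuous fun x : QSpace n × QSphere n => 1 - ‖x.1‖ ^ 2 :=
    continuous_const.sub (continuous_fst.norm.pow 2)
  exact (h1.continuousOn.div h2.continuousOn fun x hx => (one_sub_norm_sq_pos hx).ne').log
    fun x hx => (poisson_pos hx x.2).ne'

theorem continuous_log_poisson {z : QSpace n} (hz : ‖z‖ < 1) :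
    Continuous fun ζ : QSphere n => Real.log (poisson z ζ) :=
  continuousOn_log_poisson.comp_continuous (f := fun ζ => (z, ζ)) (by fun_prop) fun _ => hz

theorem integrable_of_continuous {F : Type*} [NormedAddCommGroup F] {μ : Measure (QSphere n)}
    [IsFiniteMeasure μ] {f : QSphere n → F} (hf : Continuous f) : Integrable f μ :=
  hf.integrable_of_hasCompactSupport (HasCompactSupport.of_compactSpace f)

/-- The potential whose minimum is the conformal barycenter of `μ`. -/
def potential (μ : Measure (QSphere n)) (z : QSpace n) : ℝ := ∫ ζ, Real.log (poisson z ζ) ∂μ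

/-! ### Continuity of the potential, its sign near the sphere, and existence of a minimum -/

theorem continuousOn_potential (μ : Measure (QSphere n)) [IsFiniteMeasure μ] :
    ContinuousOn (potential μ) (Metric.ball 0 1) := by
  rw [continuousOn_iff_continuous_domRestrict]
  have : LocallyCompactSpace (Metric.ball (0 : QSpace n) 1) :=
    Metric.isOpen_ball.locallyCompactSpace
  have h : Continuous (Function.uncurry fun (z : Metric.ball (0 : QSpace n) 1) (ζ : QSphere n) =>
      Real.log (poisson z.1 ζ)) :=
    continuousOn_log_poisson.comp_continuous
      (f := fun x : Metric.ball (0 : QSpace n) 1 × QSphere n => (x.1.1, x.2)) (by fun_prop)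
      fun x => mem_ball_zero_iff.1 x.1.2
  have h' := continuous_parametric_integral_of_continuous (μ := μ) h isCompact_univ
  simpa [Set.domRestrict_def, potential] using h'

/-- Put `L = -log (1 - |z|²)`, which is large near the sphere. Away from `ζ₀` the integrand is at
least `L + c`. Near `ζ₀` it may be as low as `-L - d`, but since `ζ₀` is not an atom that
neighbourhood can be given less than a quarter of the mass, and the total stays above `m L / 2`
minus a constant. -/
theorem potential_pos_near_boundary (μ : Measure (QSphere n)) [IsFiniteMeasure μ] (hμ : μ ≠ 0)
    (ζ₀ : QSphere n) (h0 : μ {ζ₀} = 0) :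
    ∃ r > 0, ∀ z : QSpace n, ‖z‖ < 1 → dist z ζ₀ < r → 0 < potential μ z := by
  have hm : 0 < μ.real Set.univ := by
    rw [measureReal_def, ENNReal.toReal_pos_iff]
    exact ⟨by simpa [pos_iff_ne_zero] using hμ, measure_lt_top _ _⟩
  set m := μ.real Set.univ with hmdef
  obtain ⟨U, hU0, hUo, hUm⟩ := Set.exists_isOpen_lt_of_lt ({ζ₀} : Set (QSphere n))
    (μ := μ) (ENNReal.ofReal (m / 4)) (by rw [h0]; exact ENNReal.ofReal_pos.2 (by linarith))
  have hUm' : μ.real U < m / 4 := by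
    rw [measureReal_def]
    exact (ENNReal.lt_ofReal_iff_toReal_lt (measure_ne_top _ _)).1 hUm
  obtain ⟨ε, hε, hball⟩ := Metric.isOpen_iff.1 hUo ζ₀ (hU0 rfl)
  set c := 2 * Real.log (ε ^ 2 / 8) with hc
  set d := 2 * Real.log 2 with hd
  set K := 2 * (|c| + |d|) with hK
  -- The first bound keeps `z` at distance at least `ε / 2` from points outside `U`, whence the
  -- constant `ε ^ 2 / 8 = (ε / 2) ^ 2 / 2`. The second gives `1 - |z|² ≤ 2 (1 - |z|) < exp (-K)`,
  -- that is `L > K`.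
  refine ⟨min (ε / 2) (Real.exp (-K) / 2), by positivity, fun z hz hzd => ?_⟩
  have hz1 : dist z ζ₀ < ε / 2 := lt_of_lt_of_le hzd (min_le_left _ _)
  have hz2 : dist z ζ₀ < Real.exp (-K) / 2 := lt_of_lt_of_le hzd (min_le_right _ _)
  have hs := one_sub_norm_sq_pos hz
  set L := -Real.log (1 - ‖z‖ ^ 2) with hL
  have hLK : K < L := by
    have h1 : 1 - ‖z‖ ^ 2 < Real.exp (-K) := by
      have h2 : ‖ζ₀.1‖ - ‖z‖ ≤ dist z ζ₀ := by
        rw [dist_comm, dist_eq_norm]; exact norm_sub_norm_le _ _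
      rw [norm_eq_of_mem_sphere] at h2
      nlinarith [norm_nonneg z]
    have h3 := Real.log_lt_log hs h1
    rw [Real.log_exp] at h3
    linarith
  have hlog : ∀ ζ : QSphere n,
      Real.log (poisson z ζ) = L + 2 * Real.log ‖1 - sdot z ζ‖ := by
    intro ζ
    have h1 : 0 < ‖1 - sdot z ζ‖ := lt_of_lt_of_le (by linarith) (one_sub_norm_le z ζ)
    rw [poisson, Real.log_div (pow_pos h1 2).ne' hs.ne', Real.log_pow]
    push_cast
    ring
  have hin : ∀ ζ ∈ U, -L - d ≤ Real.log (poisson z ζ) := by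
    intro ζ _
    have h1 : (1 - ‖z‖ ^ 2) / 2 ≤ ‖1 - sdot z ζ‖ := by
      have := one_sub_norm_le z ζ
      nlinarith [norm_nonneg z]
    have h2 := Real.log_le_log (by linarith) h1
    rw [Real.log_div hs.ne' two_ne_zero] at h2
    rw [hlog]
    linarith
  have hout : ∀ ζ ∈ Uᶜ, L + c ≤ Real.log (poisson z ζ) := by
    intro ζ hζ
    have h1 : ε ≤ dist ζ ζ₀ := by
      by_contra h
      exact hζ (hball (Metric.mem_ball.2 (not_le.1 h)))
    have h2 : ε / 2 ≤ ‖z - ζ.1‖ := by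
      have h3 := dist_triangle ζ.1 z ζ₀.1
      rw [dist_comm ζ.1 z, dist_eq_norm z ζ.1] at h3
      have h4 : dist ζ ζ₀ = dist ζ.1 ζ₀.1 := rfl
      linarith
    have h5 : ε ^ 2 / 8 ≤ ‖1 - sdot z ζ‖ := by
      refine le_trans ?_ (norm_sub_sq_le z hz.le ζ)
      nlinarith
    have h6 := Real.log_le_log (by positivity) h5
    rw [hlog]
    linarith
  have hint : Integrable (fun ζ => Real.log (poisson z ζ)) μ :=
    integrable_of_continuous (continuous_log_poisson hz)
  have hUmeas := hUo.measurableSet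
  have h1 := setIntegral_mono_on (μ := μ) (integrableOn_const (measure_ne_top _ _))
    hint.integrableOn hUmeas hin
  have h2 := setIntegral_mono_on (μ := μ) (integrableOn_const (measure_ne_top _ _))
    hint.integrableOn hUmeas.compl hout
  rw [setIntegral_const, smul_eq_mul] at h1 h2
  have h3 := integral_add_compl hUmeas hint
  have h4 : μ.real U + μ.real Uᶜ = m := measureReal_add_measureReal_compl hUmeas
  rw [potential, ← h3]
  have hu : 0 ≤ μ.real U := measureReal_nonneg
  have h5 : μ.real Uᶜ = m - μ.real U := by linarith
  rw [h5] at h2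
  have hcc := neg_abs_le c
  have hdd := le_abs_self d
  have hc0 := abs_nonneg c
  have hd0 := abs_nonneg d
  have hL0 : 0 < L := lt_of_le_of_lt (by positivity) hLK
  have e1 : 0 ≤ μ.real U * (|d| - d) := mul_nonneg hu (by linarith)
  have e2 : 0 ≤ (m - μ.real U) * (c + |c|) := mul_nonneg (by linarith) (by linarith)
  have e3 : 0 ≤ L * (m / 4 - μ.real U) := mul_nonneg hL0.le (by linarith)
  have e4 : 0 ≤ (m / 4 - μ.real U) * |d| := mul_nonneg (by linarith) hd0
  have e5 : 0 ≤ μ.real U * |c| := mul_nonneg hu hc0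
  have e6 : 0 < m * (L - K) := mul_pos hm (by linarith)
  have e7 : 0 ≤ m * |d| := mul_nonneg hm.le hd0
  nlinarith

theorem potential_zero (μ : Measure (QSphere n)) : potential μ 0 = 0 := by
  have : ∀ ζ : QSphere n, Real.log (poisson 0 ζ) = 0 := by
    intro ζ
    have : sdot (0 : QSpace n) ζ = 0 := by
      have := sdot_smul_left 0 (0 : QSpace n) ζ
      rwa [zero_smul, zero_smul] at this
    simp [poisson, this]
  simp [potential, this]

/-- Positivity near each boundary point keeps the closure of the sublevel set `Φ ≤ 0` inside the
open ball. This closure is compact and contains the origin, where `Φ = 0`, so its minimum is global.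
-/
theorem exists_isMinOn_potential (μ : Measure (QSphere n)) [IsFiniteMeasure μ] (hμ : μ ≠ 0)
    (h0 : ∀ ζ, μ {ζ} = 0) :
    ∃ z₀ : QSpace n, ‖z₀‖ < 1 ∧ ∀ z : QSpace n, ‖z‖ < 1 → potential μ z₀ ≤ potential μ z := by
  set A : Set (QSpace n) := {z | ‖z‖ < 1 ∧ potential μ z ≤ 0} with hA
  have hsub : closure A ⊆ Metric.ball 0 1 := by
    intro z hz
    have h1 : ‖z‖ ≤ 1 := by
      have : closure A ⊆ Metric.closedBall 0 1 :=
        closure_minimal (fun x hx => mem_closedBall_zero_iff.2 hx.1.le) Metric.isClosed_closedBall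
      exact mem_closedBall_zero_iff.1 (this hz)
    rcases h1.lt_or_eq with h | h
    · exact mem_ball_zero_iff.2 h
    · exfalso
      obtain ⟨r, hr, hpos⟩ := potential_pos_near_boundary μ hμ
        ⟨z, mem_sphere_zero_iff_norm.2 h⟩ (h0 _)
      obtain ⟨y, hy, hyz⟩ := Metric.mem_closure_iff.1 hz r hr
      rw [dist_comm] at hyz
      exact absurd (hpos y hy.1 hyz) (not_lt.2 hy.2)
  have hcomp : IsCompact (closure A) :=
    (isCompact_closedBall (0 : QSpace n) 1).of_isClosed_subset isClosed_closure
      (hsub.trans Metric.ball_subset_closedBall)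
  have hzero : (0 : QSpace n) ∈ A := ⟨by simp, (potential_zero μ).le⟩
  obtain ⟨z₀, hz₀, hmin⟩ := hcomp.exists_isMinOn ⟨0, subset_closure hzero⟩
    ((continuousOn_potential μ).mono hsub)
  refine ⟨z₀, mem_ball_zero_iff.1 (hsub hz₀), fun z hz => ?_⟩
  by_cases h : potential μ z ≤ 0
  · exact hmin (subset_closure ⟨hz, h⟩)
  · have h1 : potential μ z₀ ≤ potential μ 0 := hmin (subset_closure hzero)
    rw [potential_zero] at h1
    linarith

/-! ### First variation of the potential at the origin -/

theorem log_poisson_smul_le {t : ℝ} (ht : 0 < t) (m : QSpace n)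
    (hs : t ^ 2 * ‖m‖ ^ 2 ≤ 1 / 2) (ζ : QSphere n) :
    Real.log (poisson (t • m) ζ) ≤
      -2 * t * inner ℝ m ζ.1 + t ^ 2 * ‖sdot m ζ.1‖ ^ 2 + 2 * (t ^ 2 * ‖m‖ ^ 2) := by
  have hn : ‖t • m‖ ^ 2 = t ^ 2 * ‖m‖ ^ 2 := by
    rw [norm_smul, mul_pow, Real.norm_of_nonneg ht.le]
  have hlt : ‖t • m‖ < 1 := by nlinarith [norm_nonneg (t • m)]
  set s := t ^ 2 * ‖m‖ ^ 2
  have hs0 : 0 ≤ s := by positivity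
  have h1 : 0 < ‖1 - sdot (t • m) ζ.1‖ :=
    lt_of_lt_of_le (by linarith) (one_sub_norm_le _ ζ)
  have h2 : ‖1 - sdot (t • m) ζ.1‖ ^ 2 =
      1 - 2 * (t * inner ℝ m ζ.1) + t ^ 2 * ‖sdot m ζ.1‖ ^ 2 := by
    rw [norm_one_sub_sq, sdot_smul_left, norm_smul, mul_pow, Real.norm_of_nonneg ht.le,
      Quaternion.re_smul, re_sdot, smul_eq_mul]
  have h3 : 0 < 1 - s := by linarith
  rw [poisson, hn, Real.log_div (pow_pos h1 2).ne' h3.ne']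
  -- The numerator is bounded by `log x ≤ x - 1`, and the denominator by `-log (1 - s) ≤ (1 - s)⁻¹ -
  -- 1 ≤ 2 s`, valid as `s ≤ 1 / 2`.
  have h4 := Real.log_le_sub_one_of_pos (pow_pos h1 2)
  have h5 := Real.one_sub_inv_le_log_of_pos h3
  have h6 : (1 - s)⁻¹ ≤ 1 + 2 * s := by
    rw [inv_le_iff_one_le_mul₀ h3]
    nlinarith
  linarith

theorem potential_smul_le (μ : Measure (QSphere n)) [IsFiniteMeasure μ] {t : ℝ} (ht : 0 < t)
    (m : QSpace n) (hs : t ^ 2 * ‖m‖ ^ 2 ≤ 1 / 2) :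
    potential μ (t • m) ≤ -2 * t * inner ℝ m (∫ ζ, (ζ : QSpace n) ∂μ) +
      t ^ 2 * ∫ ζ : QSphere n, ‖sdot m ζ.1‖ ^ 2 ∂μ +
      μ.real Set.univ * (2 * (t ^ 2 * ‖m‖ ^ 2)) := by
  have hlt : ‖t • m‖ < 1 := by
    have hn : ‖t • m‖ ^ 2 = t ^ 2 * ‖m‖ ^ 2 := by
      rw [norm_smul, mul_pow, Real.norm_of_nonneg ht.le]
    nlinarith [norm_nonneg (t • m)]
  have hcont := continuous_sdot_coe m
  have hBi : Integrable (fun ζ : QSphere n => t ^ 2 * ‖sdot m ζ.1‖ ^ 2) μ :=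
    (integrable_of_continuous (hcont.norm.pow 2)).const_mul _
  have hmi : Integrable (fun ζ : QSphere n => (ζ : QSpace n)) μ :=
    integrable_of_continuous continuous_subtype_val
  have hmi' : Integrable (fun ζ : QSphere n => -2 * t * inner ℝ m ζ.1) μ :=
    (hmi.const_inner m).const_mul _
  have h7 := integral_mono (integrable_of_continuous (μ := μ) (continuous_log_poisson hlt))
    ((hmi'.add hBi).add (integrable_const (2 * (t ^ 2 * ‖m‖ ^ 2))))
    (fun ζ => log_poisson_smul_le ht m hs ζ)
  refine h7.trans_eq ?_
  have h8 := integral_add (hmi'.add hBi) (integrable_const (μ := μ) (2 * (t ^ 2 * ‖m‖ ^ 2)))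
  have h9 := integral_add hmi' hBi
  rw [integral_const, smul_eq_mul] at h8
  rw [integral_const_mul, integral_const_mul, integral_inner hmi] at h9
  rw [← h9]
  exact h8

theorem exists_small_parameter {a : ℝ} (C : ℝ) (ha : 0 < a) :
    ∃ t : ℝ, 0 < t ∧ t ^ 2 * a ≤ 1 / 2 ∧ t * C < 2 * a := by
  have h1 : ∀ᶠ t : ℝ in nhds 0, t ^ 2 * a < 1 / 2 := by
    have : Filter.Tendsto (fun t : ℝ => t ^ 2 * a) (nhds 0) (nhds (0 ^ 2 * a)) :=
      Continuous.tendsto (by fun_prop) 0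
    exact this.eventually (gt_mem_nhds (by norm_num))
  have h2 : ∀ᶠ t : ℝ in nhds 0, t * C < 2 * a := by
    have : Filter.Tendsto (fun t : ℝ => t * C) (nhds 0) (nhds (0 * C)) :=
      Continuous.tendsto (by fun_prop) 0
    exact this.eventually (gt_mem_nhds (by linarith))
  obtain ⟨t, ⟨h3, h4⟩, h5⟩ := (((h1.and h2).filter_mono nhdsWithin_le_nhds).and
    (self_mem_nhdsWithin (a := (0 : ℝ)) (s := Set.Ioi 0))).exists
  exact ⟨t, h5, h3.le, h4⟩

/-- Moving from the origin a small distance in the direction of the mean `m` changes the potential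
by at most `-2 t |m|² + O(t²)`, which is negative unless `m = 0`. A one-sided bound suffices, so
nothing is differentiated under the integral. -/
theorem integral_coe_eq_zero_of_potential_nonneg (μ : Measure (QSphere n)) [IsFiniteMeasure μ]
    (h : ∀ z : QSpace n, ‖z‖ < 1 → 0 ≤ potential μ z) : ∫ ζ, (ζ : QSpace n) ∂μ = 0 := by
  set m := ∫ ζ, (ζ : QSpace n) ∂μ with hm
  by_contra hne
  have hpos : 0 < ‖m‖ ^ 2 := pow_pos (norm_pos_iff.2 hne) 2
  set B := ∫ ζ : QSphere n, ‖sdot m ζ.1‖ ^ 2 ∂μ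
  obtain ⟨t, ht, ht1, ht2⟩ := exists_small_parameter
    (B + 2 * ‖m‖ ^ 2 * μ.real Set.univ) hpos
  have h1 := potential_smul_le μ ht m ht1
  rw [← hm, real_inner_self_eq_norm_sq] at h1
  have hlt : ‖t • m‖ < 1 := by
    have hn : ‖t • m‖ ^ 2 = t ^ 2 * ‖m‖ ^ 2 := by
      rw [norm_smul, mul_pow, Real.norm_of_nonneg ht.le]
    nlinarith [norm_nonneg (t • m)]
  have h2 := (h _ hlt).trans h1
  nlinarith [mul_lt_mul_of_pos_left ht2 ht]

/-! ### Equivariance of the kernel and centering of a measure -/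

theorem poisson_cay (Y : QSpace n) (hY : 0 < height Y) (hY1 : 1 + Y.snd ≠ 0) {ζ : QSphere n}
    (hζ : ζ ≠ southPole) : poisson (cay Y) ζ =
      ‖siegelKernel Y (cayInv ζ.1)‖ ^ 2 / (‖1 + (cayInv ζ.1).snd‖ ^ 2 * height Y) := by
  have h1 := one_add_snd_ne_zero hζ
  have h2 := cayInv_snd_add_ne_zero h1
  have h3 := norm_one_sub_sdot_cay Y (cayInv ζ.1) hY1 h2
  rw [cay_cayInv _ h1] at h3
  rw [poisson, h3, one_sub_norm_cay_sq Y hY1]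
  have := norm_ne_zero_iff.2 h2
  have := norm_ne_zero_iff.2 hY1
  field_simp
  ring

theorem one_add_snd_ne_zero_of_height {Y : QSpace n} (hY : 0 < height Y) : 1 + Y.snd ≠ 0 := by
  intro h
  have h1 := congrArg (fun a : ℍ[ℝ] => a.re) h
  simp only [Quaternion.re_add, Quaternion.re_one, Quaternion.re_zero] at h1
  have := sq_nonneg ‖Y.fst‖
  unfold height at hY
  linarith

theorem one_add_snd_ne_zero_of_norm_lt {z : QSpace n} (hz : ‖z‖ < 1) : 1 + z.snd ≠ 0 := by
  intro h
  have h1 := WithLp.prod_norm_sq_eq_of_L2 z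
  have h2 : z.snd = -1 := (neg_eq_of_add_eq_zero_right h).symm
  have h3 : ‖z.snd‖ = 1 := by rw [h2, norm_neg, norm_one]
  rw [h3] at h1
  nlinarith [norm_nonneg z, sq_nonneg ‖z.fst‖]

theorem height_cayInv_pos {z : QSpace n} (hz : ‖z‖ < 1) : 0 < height (cayInv z) := by
  have h1 := one_add_snd_ne_zero_of_norm_lt hz
  rw [height_cayInv z h1]
  exact div_pos (one_sub_norm_sq_pos hz) (pow_pos (norm_pos_iff.2 h1) 2)

theorem norm_cay_lt_one {Y : QSpace n} (hY : 0 < height Y) : ‖cay Y‖ < 1 := by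
  have h1 := one_add_snd_ne_zero_of_height hY
  have h2 := one_sub_norm_cay_sq Y h1
  have h3 : 0 < 4 * height Y / ‖1 + Y.snd‖ ^ 2 :=
    div_pos (by linarith) (pow_pos (norm_pos_iff.2 h1) 2)
  nlinarith [norm_nonneg (cay Y)]

/-- Moving the origin to `z₀` changes the inverse Poisson kernel by the factor `poisson z₀`. -/
theorem exists_poisson_cocycle {z₀ : QSpace n} (hz₀ : ‖z₀‖ < 1) :
    ∃ (δ : ℝ) (hδ : 0 < δ) (v : QHeis n), ∀ z' : QSpace n, ‖z'‖ < 1 →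
      ∃ z : QSpace n, ‖z‖ < 1 ∧ ∀ ζ : QSphere n, ζ ≠ southPole →
        poisson z ζ = poisson z' (sphereMap δ hδ v ζ) * poisson z₀ ζ := by
  have hY₀ := height_cayInv_pos hz₀
  -- The base point `(0, 1)` of the Siegel domain corresponds to the origin of the ball. The point
  -- `z` sought below is the preimage of `z'` under the resulting ball action.
  obtain ⟨δ, hδ, v, hb⟩ := exists_affineMap_eq_base (cayInv z₀) hY₀
  refine ⟨δ, hδ, v, fun z' hz' => ?_⟩
  have hY' := height_cayInv_pos hz'
  obtain ⟨Y, hY⟩ := affineMap_surjective hδ v (cayInv z')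
  have hhY : δ ^ 2 * height Y = height (cayInv z') := by rw [← hY, height_affineMap]
  have hhY0 : 0 < height Y := by
    rw [← hhY] at hY'
    exact pos_of_mul_pos_right hY' (sq_nonneg δ)
  refine ⟨cay Y, norm_cay_lt_one hhY0, fun ζ hζ => ?_⟩
  have hX := one_add_snd_ne_zero hζ
  have hX' := one_add_affineMap_ne_zero hδ v hζ
  have hne : sphereMap δ hδ v ζ ≠ southPole := fun h =>
    hζ ((sphereMap δ hδ v).injective (h.trans (sphereMap_southPole δ hδ v).symm))
  have hc : cayInv (sphereMap δ hδ v ζ).1 = affineMap δ v (cayInv ζ.1) := by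
    rw [coe_sphereMap δ hδ v hζ, ballMap, cayInv_cay _ hX']
  have e1 := poisson_cay Y hhY0 (one_add_snd_ne_zero_of_height hhY0) hζ
  have e2 := poisson_cay (cayInv z') hY' (one_add_snd_ne_zero_of_height hY') hne
  have e3 := poisson_cay (cayInv z₀) hY₀ (one_add_snd_ne_zero_of_height hY₀) hζ
  rw [cay_cayInv _ (one_add_snd_ne_zero_of_norm_lt hz'), hc, ← hhY, ← hY,
    siegelKernel_affineMap, norm_smul, Real.norm_of_nonneg (sq_nonneg δ)] at e2
  rw [cay_cayInv _ (one_add_snd_ne_zero_of_norm_lt hz₀)] at e3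
  have hb1 : δ ^ 2 * height (cayInv z₀) = 1 := by
    rw [← height_affineMap δ v, hb, height]
    simp
  -- The kernel at the base point `(0, 1)` is `1 + s̄`, so invariance expresses the denominator `|1
  -- + s|` at the image point through the kernel at `z₀`. This is where the factor `poisson z₀`
  -- comes from.
  have hb2 : δ ^ 2 * ‖siegelKernel (cayInv z₀) (cayInv ζ.1)‖ =
      ‖1 + (affineMap δ v (cayInv ζ.1)).snd‖ := by
    have h := congrArg norm (siegelKernel_affineMap δ v (cayInv z₀) (cayInv ζ.1))
    rw [norm_smul, Real.norm_of_nonneg (sq_nonneg δ), hb] at h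
    rw [← h, siegelKernel, ← norm_star]
    congr 1
    simp [qdot_zero_left]
  rw [e1, e2, e3, ← hb2]
  have hk : ‖siegelKernel (cayInv z₀) (cayInv ζ.1)‖ ≠ 0 := by
    intro h
    rw [h, mul_zero] at hb2
    exact hX' (norm_eq_zero.1 hb2.symm)
  have := norm_ne_zero_iff.2 (cayInv_snd_add_ne_zero hX)
  have hh : height (cayInv z₀) = (δ ^ 2)⁻¹ := eq_inv_of_mul_eq_one_right hb1
  rw [hh]
  field_simp

/-- Integrating the logarithm of the cocycle law shows that the potential of the image measure at
`z'` is `Φ(z) - Φ(z₀)`, which is nonnegative by minimality of `z₀`. -/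
theorem exists_sphereMap_integral_eq_zero (μ : Measure (QSphere n)) [IsFiniteMeasure μ]
    (h0 : ∀ ζ, μ {ζ} = 0) :
    ∃ (δ : ℝ) (hδ : 0 < δ) (v : QHeis n),
      ∫ ζ, (sphereMap δ hδ v ζ : QSpace n) ∂μ = 0 := by
  rcases eq_or_ne μ 0 with rfl | hμ
  · exact ⟨1, one_pos, 1, integral_zero_measure _⟩
  obtain ⟨z₀, hz₀, hmin⟩ := exists_isMinOn_potential μ hμ h0
  obtain ⟨δ, hδ, v, hco⟩ := exists_poisson_cocycle hz₀
  refine ⟨δ, hδ, v, ?_⟩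
  have hemb := measurableEmbedding_sphereMap δ hδ v
  rw [← hemb.integral_map (fun ζ => (ζ : QSpace n))]
  refine integral_coe_eq_zero_of_potential_nonneg _ fun z' hz' => ?_
  obtain ⟨z, hz, hp⟩ := hco z' hz'
  have hi' : Integrable (fun ζ => Real.log (poisson z' (sphereMap δ hδ v ζ))) μ :=
    hemb.integrable_map_iff.1 (integrable_of_continuous (continuous_log_poisson hz'))
  have hsum : potential μ z =
      ∫ ζ, (Real.log (poisson z' (sphereMap δ hδ v ζ)) + Real.log (poisson z₀ ζ)) ∂μ := by
    refine integral_congr_ae ?_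
    filter_upwards [measure_eq_zero_iff_ae_notMem.1 (h0 southPole)] with ζ hζ
    rw [hp ζ hζ, Real.log_mul (poisson_pos hz' _).ne' (poisson_pos hz₀ _).ne']
  rw [integral_add hi' (integrable_of_continuous (continuous_log_poisson hz₀))] at hsum
  have h1 := hmin z hz
  rw [potential, hemb.integral_map (fun ζ => Real.log (poisson z' ζ))]
  unfold potential at hsum h1
  linarith

/-! ### Centering the density of an extremizer -/

theorem IsPosExtremizer.integrable_rpow {lam : ℝ} (hlamQ : lam < hdim n) {h : QSphere n → ℝ}
    (hh : IsPosExtremizer lam h) : Integrable (fun ζ => h ζ ^ pExp n lam) (sigma n) := by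
  have hp := pExp_pos hlamQ
  have hi := hh.2.1.integrable_norm_rpow (ENNReal.ofReal_pos.2 hp).ne' ENNReal.ofReal_ne_top
  refine hi.congr ?_
  filter_upwards [hh.1] with ζ hζ
  rw [ENNReal.toReal_ofReal hp.le, Complex.norm_real, Real.norm_of_nonneg hζ.le]

theorem IsPosExtremizer.exists_integral_sphereMap_eq_zero {lam : ℝ} (hlamQ : lam < hdim n)
    {h : QSphere n → ℝ} (hh : IsPosExtremizer lam h) :
    ∃ (δ : ℝ) (hδ : 0 < δ) (v : QHeis n),
      ∫ ζ, (h ζ ^ pExp n lam) • (sphereMap δ hδ v ζ : QSpace n) ∂(sigma n) = 0 := by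
  have hi := hh.integrable_rpow hlamQ
  have := isFiniteMeasure_withDensity_ofReal hi.2
  obtain ⟨δ, hδ, v, h0⟩ := exists_sphereMap_integral_eq_zero
    ((sigma n).withDensity fun ζ => ENNReal.ofReal (h ζ ^ pExp n lam))
    (fun ζ => withDensity_absolutelyContinuous _ _ (sigma_singleton ζ))
  refine ⟨δ, hδ, v, ?_⟩
  rw [integral_withDensity_eq_integral_toReal_smul₀ hi.aemeasurable.ennreal_ofReal
    (Filter.Eventually.of_forall fun _ => ENNReal.ofReal_lt_top)] at h0
  refine Eq.trans (integral_congr_ae ?_) h0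
  filter_upwards [hh.1] with ζ hζ
  rw [ENNReal.toReal_ofReal (Real.rpow_nonneg hζ.le _)]

end QuatHLS

end

theorem mainTheorem9 (n : ℕ) (lam : ℝ) (hlam0 : 0 < lam) (hlamQ : lam < QuatHLS.hdim n)
    (h : QuatHLS.QSphere n → ℝ) (hh : QuatHLS.IsPosExtremizer lam h) :
    ∃ γ ∈ QuatHLS.AutS n,
      QuatHLS.IsPosExtremizer lam (QuatHLS.conformalTransform lam γ h) ∧
      ∫ ζ, (QuatHLS.conformalTransform lam γ h ζ ^ QuatHLS.pExp n lam) • (ζ : QuatHLS.QSpace n)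
        ∂(QuatHLS.sigma n) = 0 := by
  obtain ⟨δ, hδ, v, h0⟩ := hh.exists_integral_sphereMap_eq_zero hlamQ
  obtain ⟨v', hv'⟩ := QuatHLS.sphereMap_symm δ hδ v
  -- The transform involves `γ⁻¹`, and the invariance lemmas apply when `γ` is the inverse of a
  -- translation followed by a dilation. Such maps are closed under inversion, so the centering map
  -- has this form too.
  have hγ : QuatHLS.sphereMap δ hδ v = (QuatHLS.sphereMap δ⁻¹ (inv_pos.2 hδ) v').symm := by
    rw [← hv', Equiv.symm_symm]
  refine ⟨_, QuatHLS.sphereMap_mem_AutS δ hδ v, ?_, ?_⟩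
  · rw [hγ]
    exact QuatHLS.isPosExtremizer_conformalTransform hlamQ _ _ v' hh
  · rw [hγ, QuatHLS.integral_conformalTransform hlamQ _ _ v' hh.1, ← hγ]
    exact h0
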